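/- **Proposition 3.2.** Fix a field $\kappa$ and an integer $r\ge 0$, and let $H_r$ denote singular homology with coefficients in $\kappa$. A normal Hausdorff space $Z$ is called an ANR if, whenever $Z$ is embedded as a closed subspace of a normal Hausdorff space $Y$, there are a neighborhood $U$ of $Z$ in $Y$ and a retraction of $U$ onto $Z$. Let $X$ be an ANR. For a map $f:X\to\mathbb R$, a value $t\in\mathbb R$ is *weakly regular* for $f$ if $f^{-1}(t)$ is an ANR. A linear relation $R:V_1\rightsquigarrow V_2$ between $\kappa$-vector spaces is a linear subspace $R\subseteq V_1\times V_2$. The composition of $R_1:V_1\rightsquigarrow V_2$ and $R_2:V_2\rightsquigarrow V_3$ is $$R_2\cdot R_1=\{(v_1,v_3)\mid \exists\, v_2\in V_2:\ (v_1,v_2)\in R_1,\ (v_2,v_3)\in R_2\}.$$ For $f,g:X\to\mathbb R$ and $a<b$ put $X^{f,g}_{a,b}=g^{-1}((-\infty,b])\cap f^{-1}([a,\infty))$. If $f^{-1}(a)\subset X^{f,g}_{a,b}$ and $g^{-1}(b)\subset X^{f,g}_{a,b}$, let $$H_r(f^{-1}(a))\xrightarrow{\,i_1\,}H_r(X^{f,g}_{a,b})\xleftarrow{\,i_2\,}H_r(g^{-1}(b))$$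 be the linear maps induced by these inclusions, and let $$R^{f,g}_{a,b}(r)=\{(v_1,v_2)\mid i_1(v_1)=i_2(v_2)\}:\ H_r(f^{-1}(a))\rightsquigarrow H_r(g^{-1}(b)).$$ Let $f,g:X\to\mathbb R$ be proper continuous maps and let $t_1<t_2<t_3$ be real numbers. Suppose that $t_1$ is weakly regular for $f$, that $t_2$ is weakly regular for $g$, and that $g^{-1}(t_2)\subset f^{-1}((t_1,t_3))$. Suppose moreover that $f^{-1}(t_1)\subset g^{-1}((-\infty,t_2))$ and $f^{-1}(t_3)\subset g^{-1}((t_2,\infty))$, so that the relations below are defined. Then $$R^{g,f}_{t_2,t_3}(r)\cdot R^{f,g}_{t_1,t_2}(r)=R^{f,f}_{t_1,t_3}(r).$$ -/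

import Mathlib

open Set Topology

universe u v w x

/-! ### Absolute neighbourhood retracts -/

/-- `X` is an absolute neighbourhood retract: `X` is normal (Hausdorff) and, whenever `X` is embedded
as a closed subspace of a normal Hausdorff space `Y`, there are an open neighbourhood `U` of the
image of `X` in `Y` and a retraction of `U` onto (the image of) `X`. -/
structure IsANR (X : Type u) [TopologicalSpace X] : Prop where
  t4Space : T4Space X
  exists_retraction : ∀ (Y : Type u) [TopologicalSpace Y] [T4Space Y] (i : X → Y),
    IsClosedEmbedding i →
      ∃ U : Set Y, IsOpen U ∧ ∃ (hU : ∀ x, i x ∈ U) (ρ : C(U, X)), ∀ x, ρ ⟨i x, hU x⟩ = x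

/-- `t` is a weakly regular value of `f` if the level `f⁻¹(t)` is an ANR. -/
def IsWeaklyRegular {X : Type u} [TopologicalSpace X] (f : X → ℝ) (t : ℝ) : Prop :=
  IsANR (f ⁻¹' {t})

/-! ### Linear relations -/

/-- A linear relation from `V` to `W` is a linear subspace of `V × W`. -/
abbrev LinearRelation (κ : Type u) [Field κ] (V : Type v) (W : Type w) [AddCommGroup V] [Module κ V]
    [AddCommGroup W] [Module κ W] :=
  Submodule κ (V × W)

namespace LinearRelation

variable {κ : Type u} [Field κ] {V₁ : Type v} {V₂ : Type w} {V₃ : Type x}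
  [AddCommGroup V₁] [Module κ V₁] [AddCommGroup V₂] [Module κ V₂] [AddCommGroup V₃] [Module κ V₃]

/-- The linear relation `R(α, β) = {(v₁, v₂) | α v₁ = β v₂}` of two linear maps with common
target. -/
def ofCospan (α : V₁ →ₗ[κ] V₃) (β : V₂ →ₗ[κ] V₃) : LinearRelation κ V₁ V₂ where
  carrier := {p | α p.1 = β p.2}
  add_mem' := by
    intro p q hp hq
    change α (p.1 + q.1) = β (p.2 + q.2)
    rw [map_add, map_add, show α p.1 = β p.2 from hp, show α q.1 = β q.2 from hq]
  zero_mem' := by simp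
  smul_mem' := by
    intro c p hp
    change α (c • p.1) = β (c • p.2)
    rw [map_smul, map_smul, show α p.1 = β p.2 from hp]

/-- The composition `R₂ · R₁`: first `R₁`, then `R₂`. -/
def comp (R₂ : LinearRelation κ V₂ V₃) (R₁ : LinearRelation κ V₁ V₂) : LinearRelation κ V₁ V₃ where
  carrier := {p | ∃ v₂ : V₂, (p.1, v₂) ∈ R₁ ∧ (v₂, p.2) ∈ R₂}
  add_mem' := by
    rintro p q ⟨v, h₁, h₂⟩ ⟨v', h₁', h₂'⟩
    exact ⟨v + v', R₁.add_mem h₁ h₁', R₂.add_mem h₂ h₂'⟩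
  zero_mem' := ⟨0, R₁.zero_mem, R₂.zero_mem⟩
  smul_mem' := by
    rintro c p ⟨v, h₁, h₂⟩
    exact ⟨c • v, R₁.smul_mem c h₁, R₂.smul_mem c h₂⟩

end LinearRelation

/-! ### Singular homology with coefficients in a field -/

/-- `H_r(S; κ)`: the `r`-th singular homology of `S` with coefficients in the field `κ`. -/
noncomputable abbrev singularHomology (κ : Type u) [Field κ] (r : ℕ) (S : Type u)
    [TopologicalSpace S] : ModuleCat.{u} κ :=
  ((AlgebraicTopology.singularHomologyFunctor (ModuleCat.{u} κ) r).obj (ModuleCat.of κ κ)).obj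
    (TopCat.of S)

/-- The linear map `H_r(A; κ) → H_r(B; κ)` induced by an inclusion `A ⊆ B` of subspaces of `X`. -/
noncomputable def singularHomologyInclusion (κ : Type u) [Field κ] (r : ℕ) {X : Type u}
    [TopologicalSpace X] {A B : Set X} (h : A ⊆ B) :
    singularHomology κ r A →ₗ[κ] singularHomology κ r B :=
  (((AlgebraicTopology.singularHomologyFunctor (ModuleCat.{u} κ) r).obj (ModuleCat.of κ κ)).map
    (TopCat.ofHom ⟨Set.inclusion h, continuous_inclusion h⟩)).hom

/-! ### The linear relation between two levels -/

section Levels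

variable {X : Type u} (f g : X → ℝ) (a b : ℝ)

/-- `X^{f,g}_{a,b}`: the intersection of the sub-level `{g ≤ b}` with the super-level `{f ≥ a}`. -/
def levelRegion : Set X := g ⁻¹' Iic b ∩ f ⁻¹' Ici a

variable {f g a b}

theorem level_left_subset (h : f ⁻¹' {a} ⊆ g ⁻¹' Iio b) : f ⁻¹' {a} ⊆ levelRegion f g a b :=
  subset_inter (h.trans (preimage_mono Iio_subset_Iic_self))
    (preimage_mono (singleton_subset_iff.2 self_mem_Ici))

theorem level_right_subset (h : g ⁻¹' {b} ⊆ f ⁻¹' Ioi a) : g ⁻¹' {b} ⊆ levelRegion f g a b :=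
  subset_inter (preimage_mono (singleton_subset_iff.2 self_mem_Iic))
    (h.trans (preimage_mono Ioi_subset_Ici_self))

theorem level_subset_Iio (h : a < b) : f ⁻¹' {a} ⊆ f ⁻¹' Iio b :=
  preimage_mono (singleton_subset_iff.2 h)

theorem level_subset_Ioi (h : a < b) : f ⁻¹' {b} ⊆ f ⁻¹' Ioi a :=
  preimage_mono (singleton_subset_iff.2 h)

end Levels

/-- The linear relation `R^{f,g}_{a,b}(r)` from `H_r(f⁻¹(a))` to `H_r(g⁻¹(b))` defined by the linear
maps which the inclusions of the levels `f⁻¹(a)` and `g⁻¹(b)` into `X^{f,g}_{a,b}` induce. -/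
noncomputable def levelRelation (κ : Type u) [Field κ] (r : ℕ) {X : Type u} [TopologicalSpace X]
    (f g : X → ℝ) (a b : ℝ) (ha : f ⁻¹' {a} ⊆ levelRegion f g a b)
    (hb : g ⁻¹' {b} ⊆ levelRegion f g a b) :
    LinearRelation κ (singularHomology κ r (f ⁻¹' {a})) (singularHomology κ r (g ⁻¹' {b})) :=
  LinearRelation.ofCospan (singularHomologyInclusion κ r ha) (singularHomologyInclusion κ r hb)

/-!
Write `A = {f ≥ t₁, g ≤ t₂}`, `B = {g ≥ t₂, f ≤ t₃}`, `L = g⁻¹(t₂)` and `S = {t₁ ≤ f ≤ t₃}`. The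
sets `A` and `B` meet in `L`, and `S` is a closed and open part of `A ∪ B`, so that the homology of
`S` injects into that of `A ∪ B` (`singularHomologyInclusion_injective`); this gives the inclusion
of the composed relation in `R^{f,f}`. The other inclusion is the exactness of the Mayer–Vietoris
sequence of `A` and `B` at its middle term: classes of `A` and `B` which agree in `A ∪ B` come from
a class of `L` (`exists_level_singularHomologyInclusion_eq`).

As `A` and `B` are closed, this needs more than excision. Because `f` is proper, `X` embeds as a
closed subspace of the normal convex space `ℝ × [0,1]^J`; the retractions which `X` and `L` have as
ANRs, together with straight line homotopies in that space, provide a neighbourhood of `L` which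
deforms to `L` inside `X`, relative to `L` (`IsANR.exists_deformation`). Hence `A` and `B` can be
thickened to sets `A ∪ V` and `B ∪ V` which are open in their union and intersect in a small
neighbourhood `V` of `L`. For these, Mayer–Vietoris holds (`exists_singularHomologyInclusion_eq`),
and the class of `V` which it yields is moved to `L` by the retraction. That this gives back the
original class of `A` follows by folding the part of the deformation on the other side of the level
to `L` (`singularHomologyInclusion_retraction`).

Mayer–Vietoris for relatively open sets rests on barycentric subdivision. It is carried out
for formal chains of tuples of points, where the subdivision and its chain homotopy to the identity
are defined recursively by cones, and is transferred to singular chains by composing singular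
simplices with affine maps. Chains are indexed by the number of vertices and are augmented, which
makes the cone formulas uniform in the degree.
-/

/-! ### Chains of tuples and barycentric subdivision -/

/-- The module of formal linear combinations of `n`-tuples of points of `V`. A tuple of length `n`
plays the role of a (possibly degenerate) affine simplex of dimension `n - 1`, so that these modules
form an *augmented* chain complex, the empty tuple spanning the part of dimension `-1`. -/
abbrev TupleChain (κ : Type*) [Field κ] (V : Type*) (n : ℕ) := (Fin n → V) →₀ κ

namespace TupleChain

variable {κ : Type*} [Field κ] {V W : Type*}

/-- The alternating sum of the faces of a tuple. -/
noncomputable def boundary (n : ℕ) : TupleChain κ V (n + 1) →ₗ[κ] TupleChain κ V n :=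
  Finsupp.linearCombination κ fun v =>
    ∑ j : Fin (n + 1), (-1 : κ) ^ (j : ℕ) • Finsupp.single (v ∘ j.succAbove) 1

/-- The cone with apex `b`: prepend `b` to every tuple. -/
noncomputable def cone (b : V) (n : ℕ) : TupleChain κ V n →ₗ[κ] TupleChain κ V (n + 1) :=
  Finsupp.lmapDomain κ κ fun v => (Fin.cons b v : Fin (n + 1) → V)

/-- The map on chains of tuples induced by a map of points. -/
noncomputable def map (f : V → W) (n : ℕ) : TupleChain κ V n →ₗ[κ] TupleChain κ W n :=
  Finsupp.lmapDomain κ κ fun v => f ∘ v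

theorem boundary_single (n : ℕ) (v : Fin (n + 1) → V) :
    boundary n (Finsupp.single v (1 : κ)) =
      ∑ j : Fin (n + 1), (-1 : κ) ^ (j : ℕ) • Finsupp.single (v ∘ j.succAbove) 1 := by
  simp [boundary]

@[simp]
theorem cone_single (b : V) (n : ℕ) (v : Fin n → V) (c : κ) :
    cone b n (Finsupp.single v c) = Finsupp.single (Fin.cons b v : Fin (n + 1) → V) c := by
  simp [cone]

@[simp]
theorem map_single (f : V → W) (n : ℕ) (v : Fin n → V) (c : κ) :
    map f n (Finsupp.single v c) = Finsupp.single (f ∘ v) c := by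
  simp [map]

theorem boundary_cone_zero (b : V) (c : TupleChain κ V 0) : boundary 0 (cone b 0 c) = c := by
  have : boundary 0 ∘ₗ cone b 0 = (LinearMap.id : TupleChain κ V 0 →ₗ[κ] _) := by
    ext1 v
    ext1
    simp only [LinearMap.comp_apply, Finsupp.lsingle_apply, cone_single, boundary_single,
      LinearMap.id_apply]
    simp only [Fin.sum_univ_succ, Finset.univ_eq_empty, Finset.sum_empty, add_zero, Fin.val_zero,
      pow_zero, one_smul]
    congr 1
  exact LinearMap.congr_fun this c

theorem boundary_cone_succ (b : V) (n : ℕ) (c : TupleChain κ V (n + 1)) :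
    boundary (n + 1) (cone b (n + 1) c) = c - cone b n (boundary n c) := by
  have : boundary (n + 1) ∘ₗ cone b (n + 1) =
      (LinearMap.id - cone b n ∘ₗ boundary n : TupleChain κ V (n + 1) →ₗ[κ] _) := by
    ext1 v
    ext1
    simp only [LinearMap.comp_apply, Finsupp.lsingle_apply, cone_single, boundary_single,
      LinearMap.id_apply, LinearMap.sub_apply, map_sum, map_smul]
    rw [Fin.sum_univ_succ, sub_eq_add_neg, ← Finset.sum_neg_distrib]
    congr 1
    · simp only [Fin.val_zero, pow_zero, one_smul]
      congr 1
    · refine Finset.sum_congr rfl fun j _ => ?_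
      rw [Fin.val_succ, pow_succ, mul_neg_one, neg_smul]
      congr 3
      funext i
      refine Fin.cases ?_ (fun i => ?_) i <;> simp
  exact LinearMap.congr_fun this c

/-- Every tuple is a cone over its tail, so `∂∂ = 0` follows by induction from the formula for the
boundary of a cone. -/
theorem boundary_boundary (n : ℕ) (c : TupleChain κ V (n + 2)) :
    boundary n (boundary (n + 1) c) = 0 := by
  induction n with
  | zero =>
    induction c using Finsupp.induction_linear with
    | zero => simp
    | add c d hc hd => simp [hc, hd]
    | single v a =>
      rw [← Fin.cons_self_tail v, ← cone_single, boundary_cone_succ, map_sub, boundary_cone_zero,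
        sub_self]
  | succ n ih =>
    induction c using Finsupp.induction_linear with
    | zero => simp
    | add c d hc hd => simp [hc, hd]
    | single v a =>
      rw [← Fin.cons_self_tail v, ← cone_single, boundary_cone_succ, map_sub, boundary_cone_succ,
        ih, map_zero, sub_zero, sub_self]

theorem boundary_map (f : V → W) (n : ℕ) (c : TupleChain κ V (n + 1)) :
    boundary n (map f (n + 1) c) = map f n (boundary n c) := by
  have : boundary n ∘ₗ map f (n + 1) =
      (map f n ∘ₗ boundary n : TupleChain κ V (n + 1) →ₗ[κ] _) := by
    ext1 v
    ext1
    simp [boundary_single, Function.comp_assoc]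
  exact LinearMap.congr_fun this c

theorem map_cone (f : V → W) (b : V) (n : ℕ) (c : TupleChain κ V n) :
    map f (n + 1) (cone b n c) = cone (f b) n (map f n c) := by
  have : map f (n + 1) ∘ₗ cone b n = (cone (f b) n ∘ₗ map f n : TupleChain κ V n →ₗ[κ] _) := by
    ext1 v
    ext1
    simp only [LinearMap.comp_apply, Finsupp.lsingle_apply, cone_single, map_single]
    congr 1
    funext i
    refine Fin.cases ?_ (fun i => ?_) i <;> simp
  exact LinearMap.congr_fun this c

section Subdivision

variable (β : ∀ n, (Fin (n + 1) → V) → V)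

/-- Barycentric subdivision, with respect to a choice `β` of a "barycentre" of every nonempty tuple:
the subdivision of a tuple is the cone from its barycentre over the subdivision of its boundary. -/
noncomputable def subdivision : ∀ n, TupleChain κ V n →ₗ[κ] TupleChain κ V n
  | 0 => LinearMap.id
  | n + 1 => Finsupp.linearCombination κ fun v =>
      cone (β n v) n (subdivision n (boundary n (Finsupp.single v 1)))

/-- The chain homotopy between the identity and barycentric subdivision. -/
noncomputable def subdivisionHomotopy : ∀ n, TupleChain κ V n →ₗ[κ] TupleChain κ V (n + 1)
  | 0 => 0
  | n + 1 => Finsupp.linearCombination κ fun v => cone (β n v) (n + 1)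
      (Finsupp.single v 1 - subdivisionHomotopy n (boundary n (Finsupp.single v 1)))

theorem subdivision_succ_single (n : ℕ) (v : Fin (n + 1) → V) :
    subdivision β (n + 1) (Finsupp.single v (1 : κ)) =
      cone (β n v) n (subdivision β n (boundary n (Finsupp.single v 1))) := by
  simp [subdivision]

theorem subdivisionHomotopy_succ_single (n : ℕ) (v : Fin (n + 1) → V) :
    subdivisionHomotopy β (n + 1) (Finsupp.single v (1 : κ)) = cone (β n v) (n + 1)
      (Finsupp.single v 1 - subdivisionHomotopy β n (boundary n (Finsupp.single v 1))) := by
  simp [subdivisionHomotopy]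

theorem boundary_subdivision (n : ℕ) (c : TupleChain κ V (n + 1)) :
    boundary n (subdivision β (n + 1) c) = subdivision β n (boundary n c) := by
  have : boundary n ∘ₗ subdivision β (n + 1) =
      (subdivision β n ∘ₗ boundary n : TupleChain κ V (n + 1) →ₗ[κ] _) := by
    clear c
    induction n with
    | zero =>
      ext1 v
      ext1
      simp only [LinearMap.comp_apply, Finsupp.lsingle_apply, subdivision_succ_single,
        boundary_cone_zero]
    | succ n ih =>
      ext1 v
      ext1
      have h := LinearMap.congr_fun ih (boundary (n + 1) (Finsupp.single v 1))
      simp only [LinearMap.comp_apply] at h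
      simp only [LinearMap.comp_apply, Finsupp.lsingle_apply, subdivision_succ_single,
        boundary_cone_succ, h, boundary_boundary, map_zero, sub_zero]
  exact LinearMap.congr_fun this c

theorem boundary_subdivisionHomotopy (n : ℕ) (c : TupleChain κ V (n + 1)) :
    boundary (n + 1) (subdivisionHomotopy β (n + 1) c) +
      subdivisionHomotopy β n (boundary n c) = c - subdivision β (n + 1) c := by
  have : boundary (n + 1) ∘ₗ subdivisionHomotopy β (n + 1) + subdivisionHomotopy β n ∘ₗ boundary n =
      (LinearMap.id - subdivision β (n + 1) : TupleChain κ V (n + 1) →ₗ[κ] _) := by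
    clear c
    induction n with
    | zero =>
      ext1 v
      ext1
      simp only [LinearMap.comp_apply, Finsupp.lsingle_apply, subdivisionHomotopy_succ_single,
        LinearMap.add_apply, LinearMap.sub_apply, LinearMap.id_apply, subdivision_succ_single,
        boundary_cone_succ]
      simp [subdivisionHomotopy, subdivision]
    | succ n ih =>
      ext1 v
      ext1
      have h := LinearMap.congr_fun ih (boundary (n + 1) (Finsupp.single v 1))
      simp only [LinearMap.comp_apply, LinearMap.add_apply, LinearMap.sub_apply, LinearMap.id_apply,
        boundary_boundary, map_zero, add_zero] at h
      simp only [LinearMap.comp_apply, Finsupp.lsingle_apply, subdivisionHomotopy_succ_single,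
        LinearMap.add_apply, LinearMap.sub_apply, LinearMap.id_apply, subdivision_succ_single,
        boundary_cone_succ, map_sub, h]
      abel
  exact LinearMap.congr_fun this c

theorem boundary_subdivision_pow (k n : ℕ) (c : TupleChain κ V (n + 1)) :
    boundary n ((subdivision β (n + 1) ^ k) c) = (subdivision β n ^ k) (boundary n c) := by
  induction k with
  | zero => simp
  | succ k ih => rw [pow_succ', pow_succ', Module.End.mul_apply, boundary_subdivision, ih]; rfl

/-- The chain homotopy between the identity and the `k`-fold barycentric subdivision. -/
noncomputable def iteratedHomotopy (k n : ℕ) : TupleChain κ V n →ₗ[κ] TupleChain κ V (n + 1) :=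
  ∑ i ∈ Finset.range k, subdivisionHomotopy β n ∘ₗ subdivision β n ^ i

theorem iteratedHomotopy_zero_right (k : ℕ) : iteratedHomotopy (κ := κ) β k 0 = 0 := by
  simp [iteratedHomotopy, subdivisionHomotopy]

theorem boundary_iteratedHomotopy (k n : ℕ) (c : TupleChain κ V (n + 1)) :
    boundary (n + 1) (iteratedHomotopy β k (n + 1) c) + iteratedHomotopy β k n (boundary n c) =
      c - (subdivision β (n + 1) ^ k) c := by
  induction k with
  | zero => simp [iteratedHomotopy]
  | succ k ih =>
    have h := boundary_subdivisionHomotopy β n ((subdivision β (n + 1) ^ k) c)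
    rw [boundary_subdivision_pow] at h
    have e : ∀ m, iteratedHomotopy (κ := κ) β (k + 1) m =
        iteratedHomotopy β k m + subdivisionHomotopy β m ∘ₗ subdivision β m ^ k := fun m => by
      rw [iteratedHomotopy, Finset.sum_range_succ]; rfl
    rw [e, e, LinearMap.add_apply, LinearMap.add_apply, map_add, LinearMap.comp_apply,
      LinearMap.comp_apply, add_add_add_comm, ih, h, pow_succ', Module.End.mul_apply]
    abel

variable {β} {γ : ∀ n, (Fin (n + 1) → W) → W} {f : V → W}

theorem map_subdivision (hf : ∀ n v, f (β n v) = γ n (f ∘ v)) (n : ℕ) (c : TupleChain κ V n) :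
    map f n (subdivision β n c) = subdivision γ n (map f n c) := by
  have : map f n ∘ₗ subdivision β n =
      (subdivision γ n ∘ₗ map f n : TupleChain κ V n →ₗ[κ] _) := by
    clear c
    induction n with
    | zero => ext1; ext1; simp [subdivision]
    | succ n ih =>
      ext1 v
      ext1
      have h := LinearMap.congr_fun ih (boundary n (Finsupp.single v 1))
      simp only [LinearMap.comp_apply] at h
      simp only [LinearMap.comp_apply, Finsupp.lsingle_apply, map_single, subdivision_succ_single,
        map_cone, hf, h, ← boundary_map]
  exact LinearMap.congr_fun this c

theorem map_subdivisionHomotopy (hf : ∀ n v, f (β n v) = γ n (f ∘ v)) (n : ℕ)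
    (c : TupleChain κ V n) :
    map f (n + 1) (subdivisionHomotopy β n c) = subdivisionHomotopy γ n (map f n c) := by
  have : map f (n + 1) ∘ₗ subdivisionHomotopy β n =
      (subdivisionHomotopy γ n ∘ₗ map f n : TupleChain κ V n →ₗ[κ] _) := by
    clear c
    induction n with
    | zero => ext1; ext1; simp [subdivisionHomotopy]
    | succ n ih =>
      ext1 v
      ext1
      have h := LinearMap.congr_fun ih (boundary n (Finsupp.single v 1))
      simp only [LinearMap.comp_apply] at h
      simp only [LinearMap.comp_apply, Finsupp.lsingle_apply, map_single, map_sub,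
        subdivisionHomotopy_succ_single, map_cone, hf, h, ← boundary_map]
  exact LinearMap.congr_fun this c

theorem map_subdivision_pow (hf : ∀ n v, f (β n v) = γ n (f ∘ v)) (k n : ℕ)
    (c : TupleChain κ V n) :
    map f n ((subdivision β n ^ k) c) = (subdivision γ n ^ k) (map f n c) := by
  induction k with
  | zero => simp
  | succ k ih =>
    rw [pow_succ', pow_succ', Module.End.mul_apply, map_subdivision hf, ih]; rfl

theorem map_iteratedHomotopy (hf : ∀ n v, f (β n v) = γ n (f ∘ v)) (k n : ℕ)
    (c : TupleChain κ V n) :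
    map f (n + 1) (iteratedHomotopy β k n c) = iteratedHomotopy γ k n (map f n c) := by
  simp only [iteratedHomotopy, LinearMap.sum_apply, map_sum, LinearMap.comp_apply,
    map_subdivisionHomotopy hf, map_subdivision_pow hf]

end Subdivision

/-! ### The mesh of the barycentric subdivision -/

section Mesh

theorem boundary_mem_supported {n : ℕ} {P : Set (Fin (n + 1) → V)} {Q : Set (Fin n → V)}
    (h : ∀ v ∈ P, ∀ j : Fin (n + 1), v ∘ j.succAbove ∈ Q) {c : TupleChain κ V (n + 1)}
    (hc : c ∈ Finsupp.supported κ κ P) : boundary n c ∈ Finsupp.supported κ κ Q := by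
  rw [Finsupp.supported_eq_span_single] at hc
  refine Submodule.span_induction (p := fun c _ => boundary n c ∈ Finsupp.supported κ κ Q)
    ?_ (by simp) (fun _ _ _ _ h₁ h₂ => by rw [map_add]; exact Submodule.add_mem _ h₁ h₂)
    (fun a _ _ h => by rw [map_smul]; exact Submodule.smul_mem _ a h) hc
  rintro _ ⟨v, hv, rfl⟩
  rw [boundary_single]
  exact Submodule.sum_mem _ fun j _ => Submodule.smul_mem _ _
    (Finsupp.single_mem_supported κ _ (h v hv j))

theorem cone_mem_supported {n : ℕ} {P : Set (Fin n → V)} {Q : Set (Fin (n + 1) → V)} {b : V}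
    (h : ∀ v ∈ P, (Fin.cons b v : Fin (n + 1) → V) ∈ Q) {c : TupleChain κ V n}
    (hc : c ∈ Finsupp.supported κ κ P) : cone b n c ∈ Finsupp.supported κ κ Q := by
  rw [Finsupp.supported_eq_span_single] at hc
  refine Submodule.span_induction (p := fun c _ => cone b n c ∈ Finsupp.supported κ κ Q)
    ?_ (by simp) (fun _ _ _ _ h₁ h₂ => by rw [map_add]; exact Submodule.add_mem _ h₁ h₂)
    (fun a _ _ h => by rw [map_smul]; exact Submodule.smul_mem _ a h) hc
  rintro _ ⟨v, hv, rfl⟩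
  rw [cone_single]
  exact Finsupp.single_mem_supported κ _ (h v hv)

/-- To bound the support of the subdivision of a chain it suffices to consider tuples. -/
theorem subdivision_mem_supported {β : ∀ n, (Fin (n + 1) → V) → V} {n : ℕ}
    {P Q : Set (Fin n → V)}
    (h : ∀ v ∈ P, subdivision β n (Finsupp.single v (1 : κ)) ∈ Finsupp.supported κ κ Q)
    {c : TupleChain κ V n} (hc : c ∈ Finsupp.supported κ κ P) :
    subdivision β n c ∈ Finsupp.supported κ κ Q := by
  rw [Finsupp.supported_eq_span_single] at hc
  refine Submodule.span_induction (p := fun c _ => subdivision β n c ∈ Finsupp.supported κ κ Q)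
    ?_ (by simp) (fun _ _ _ _ h₁ h₂ => by rw [map_add]; exact Submodule.add_mem _ h₁ h₂)
    (fun a _ _ h => by rw [map_smul]; exact Submodule.smul_mem _ a h) hc
  rintro _ ⟨v, hv, rfl⟩
  exact h v hv

/-- Subdivision does not leave a set that contains the barycentres of its tuples. -/
theorem subdivision_mem_supported_of_closed {β : ∀ n, (Fin (n + 1) → V) → V} {K : Set V}
    (hK : ∀ n v, (∀ i, v i ∈ K) → β n v ∈ K) (n : ℕ) {c : TupleChain κ V n}
    (hc : c ∈ Finsupp.supported κ κ {v | ∀ i, v i ∈ K}) :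
    subdivision β n c ∈ Finsupp.supported κ κ {v | ∀ i, v i ∈ K} := by
  induction n with
  | zero => exact hc
  | succ n ih =>
    refine subdivision_mem_supported (fun v hv => ?_) hc
    rw [subdivision_succ_single]
    refine cone_mem_supported (P := {v | ∀ i, v i ∈ K}) (fun w hw i => ?_)
      (ih (boundary_mem_supported (P := {v | ∀ i, v i ∈ K})
        (Q := {v | ∀ i, v i ∈ K}) (fun w hw j i => hw _)
        (Finsupp.single_mem_supported κ (1 : κ) hv)))
    refine Fin.cases ?_ (fun i => ?_) i
    · simpa using hK n v hv
    · simpa using hw i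

variable [PseudoMetricSpace V]

/-- If barycentres of `n`-tuples with `n ≤ N + 1` lie at distance at most `q` times the diameter
from the vertices, then one subdivision shrinks the diameter of all simplices by the factor `q`. -/
theorem subdivision_mem_supported_dist_le {β : ∀ n, (Fin (n + 1) → V) → V} {N : ℕ} {q : ℝ}
    (hball : ∀ n v (u : V) e, (∀ i, dist (v i) u ≤ e) → dist (β n v) u ≤ e)
    (hq : 0 ≤ q)
    (hshrink : ∀ n v d, n ≤ N → (∀ i j, dist (v i) (v j) ≤ d) → ∀ i, dist (v i) (β n v) ≤ q * d)
    {n : ℕ} (hn : n ≤ N + 1) {d : ℝ} (hd : 0 ≤ d) {c : TupleChain κ V n}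
    (hc : c ∈ Finsupp.supported κ κ {v | ∀ i j, dist (v i) (v j) ≤ d}) :
    subdivision β n c ∈ Finsupp.supported κ κ {v | ∀ i j, dist (v i) (v j) ≤ q * d} := by
  induction n with
  | zero =>
    rw [Finsupp.mem_supported]
    intro v _ i
    exact i.elim0
  | succ n ih =>
    refine subdivision_mem_supported (fun v hv => ?_) hc
    rw [subdivision_succ_single]
    have h₁ := ih (by omega) (boundary_mem_supported (κ := κ)
      (P := {v | ∀ i j, dist (v i) (v j) ≤ d}) (Q := {v | ∀ i j, dist (v i) (v j) ≤ d})
      (fun w hw j i i' => hw _ _) (Finsupp.single_mem_supported κ (1 : κ) hv))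
    have hcl := hshrink n v d (by omega) hv
    have h₂ := subdivision_mem_supported_of_closed (κ := κ) (β := β)
      (K := {x | dist x (β n v) ≤ q * d})
      (fun m w hw => hball m w _ _ hw) n (boundary_mem_supported (κ := κ)
      (P := {w | ∀ i, w i ∈ {x | dist x (β n v) ≤ q * d}})
      (Q := {w | ∀ i, w i ∈ {x | dist x (β n v) ≤ q * d}})
      (fun w hw j i => hw _) (Finsupp.single_mem_supported κ (1 : κ) hcl))
    have h₃ := (Finsupp.supported_inter (R := κ) (M := κ) _ _).ge ⟨h₁, h₂⟩
    refine cone_mem_supported (fun w hw i j => ?_) h₃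
    refine Fin.cases ?_ (fun i => ?_) i <;> refine Fin.cases ?_ (fun j => ?_) j
    · simpa using mul_nonneg hq hd
    · simpa [dist_comm] using hw.2 j
    · simpa using hw.2 i
    · simpa using hw.1 i j

theorem subdivision_pow_mem_supported_dist_le {β : ∀ n, (Fin (n + 1) → V) → V} {N : ℕ} {q : ℝ}
    (hball : ∀ n v (u : V) e, (∀ i, dist (v i) u ≤ e) → dist (β n v) u ≤ e)
    (hq : 0 ≤ q)
    (hshrink : ∀ n v d, n ≤ N → (∀ i j, dist (v i) (v j) ≤ d) → ∀ i, dist (v i) (β n v) ≤ q * d)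
    {n : ℕ} (hn : n ≤ N + 1) {d : ℝ} (hd : 0 ≤ d) {c : TupleChain κ V n}
    (hc : c ∈ Finsupp.supported κ κ {v | ∀ i j, dist (v i) (v j) ≤ d}) (k : ℕ) :
    (subdivision β n ^ k) c ∈
      Finsupp.supported κ κ {v | ∀ i j, dist (v i) (v j) ≤ q ^ k * d} := by
  induction k with
  | zero => simpa using hc
  | succ k ih =>
    rw [pow_succ', pow_succ', mul_assoc]
    exact subdivision_mem_supported_dist_le hball hq hshrink hn (by positivity) ih

end Mesh

end TupleChain

/-! ### Singular chains and their subdivision -/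

namespace stdSimplex

/-- The affine map between standard simplices with prescribed images of the vertices. -/
noncomputable def affineMap {n m : ℕ} (v : Fin n → stdSimplex ℝ (Fin m)) :
    C(stdSimplex ℝ (Fin n), stdSimplex ℝ (Fin m)) where
  toFun x := ⟨∑ i, x i • (v i : Fin m → ℝ),
    (convex_stdSimplex ℝ (Fin m)).sum_mem (fun i _ => x.2.1 i) x.2.2 fun i _ => (v i).2⟩
  continuous_toFun := by
    refine Continuous.subtype_mk (continuous_finsetSum _ fun i _ => ?_) _
    exact ((continuous_apply i).comp continuous_subtype_val).smul continuous_const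

theorem affineMap_coe {n m : ℕ} (v : Fin n → stdSimplex ℝ (Fin m)) (x : stdSimplex ℝ (Fin n)) :
    (affineMap v x : Fin m → ℝ) = ∑ i, x i • (v i : Fin m → ℝ) := rfl

theorem affineMap_comp {n m l : ℕ} (v : Fin n → stdSimplex ℝ (Fin m))
    (w : Fin l → stdSimplex ℝ (Fin n)) :
    affineMap (affineMap v ∘ w) = (affineMap v).comp (affineMap w) := by
  ext1 x
  refine stdSimplex.ext ?_
  have h : ∀ i, (affineMap w x) i = ∑ j, x j • (w j) i := fun i => by
    rw [affineMap_coe, Finset.sum_apply]; rfl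
  simp only [ContinuousMap.comp_apply, affineMap_coe, Function.comp_apply, h, Finset.smul_sum,
    Finset.sum_smul, smul_smul, smul_eq_mul]
  rw [Finset.sum_comm]

theorem affineMap_vertex {n m : ℕ} (v : Fin n → stdSimplex ℝ (Fin m)) (i : Fin n) :
    affineMap v (vertex i) = v i := by
  refine stdSimplex.ext ?_
  rw [affineMap_coe, Finset.sum_eq_single i]
  · change (Pi.single i (1 : ℝ) : Fin n → ℝ) i • _ = _
    simp
  · intro j _ hj
    change (Pi.single i (1 : ℝ) : Fin n → ℝ) j • _ = _
    simp [hj]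
  · simp

theorem affineMap_comp_vertex {n m : ℕ} (v : Fin n → stdSimplex ℝ (Fin m)) :
    affineMap v ∘ vertex = v := funext (affineMap_vertex v)

theorem affineMap_comp_reindex {n m l : ℕ} (v : Fin n → stdSimplex ℝ (Fin m)) (f : Fin l → Fin n) :
    affineMap (v ∘ f) = (affineMap v).comp (affineMap (vertex ∘ f)) := by
  rw [← affineMap_comp, ← Function.comp_assoc, affineMap_comp_vertex]

theorem affineMap_vertex_reindex {n l : ℕ} (f : Fin l → Fin n) (x : stdSimplex ℝ (Fin l)) :
    affineMap (vertex ∘ f) x = stdSimplex.map f x := by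
  refine stdSimplex.ext ?_
  rw [affineMap_coe, stdSimplex.map_coe]
  funext k
  rw [FunOnFinite.linearMap_apply_apply, Finset.sum_apply, Finset.sum_filter]
  refine Finset.sum_congr rfl fun i _ => ?_
  change x i • (Pi.single (f i) (1 : ℝ) : Fin n → ℝ) k = _
  by_cases h : f i = k
  · subst h; simp
  · simp [h, Ne.symm h]

theorem affineMap_vertex_eq_id (n : ℕ) :
    affineMap (vertex : Fin n → stdSimplex ℝ (Fin n)) = ContinuousMap.id _ := by
  ext1 x
  have := affineMap_vertex_reindex (id : Fin n → Fin n) x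
  rwa [Function.comp_id, stdSimplex.map_id_apply] at this

/-- The barycentre of a nonempty tuple of points of a standard simplex. -/
noncomputable def tupleBarycenter {m : ℕ} (n : ℕ) (v : Fin (n + 1) → stdSimplex ℝ (Fin m)) :
    stdSimplex ℝ (Fin m) :=
  affineMap v barycenter

theorem affineMap_tupleBarycenter {m l : ℕ} (v : Fin m → stdSimplex ℝ (Fin l)) (n : ℕ)
    (w : Fin (n + 1) → stdSimplex ℝ (Fin m)) :
    affineMap v (tupleBarycenter n w) = tupleBarycenter n (affineMap v ∘ w) := by
  rw [tupleBarycenter, tupleBarycenter, affineMap_comp]; rfl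

theorem dist_affineMap_le {n m : ℕ} {v : Fin n → stdSimplex ℝ (Fin m)} {u : stdSimplex ℝ (Fin m)}
    {e : ℝ} (h : ∀ i, dist (v i) u ≤ e) (x : stdSimplex ℝ (Fin n)) :
    dist (affineMap v x) u ≤ e := by
  have := (convex_closedBall (u : Fin m → ℝ) e).sum_mem (t := Finset.univ) (w := x)
    (z := fun i => (v i : Fin m → ℝ)) (fun i _ => x.2.1 i) x.2.2
    fun i _ => Metric.mem_closedBall.2 (h i)
  exact Metric.mem_closedBall.1 this

theorem dist_tupleBarycenter_le {m N n : ℕ} (v : Fin (n + 1) → stdSimplex ℝ (Fin m)) {d : ℝ}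
    (hn : n ≤ N) (h : ∀ i j, dist (v i) (v j) ≤ d) (i : Fin (n + 1)) :
    dist (v i) (tupleBarycenter n v) ≤ (N / (N + 1) : ℝ) * d := by
  have hd : 0 ≤ d := (dist_nonneg).trans (h i i)
  have hN : (n / (n + 1) : ℝ) ≤ N / (N + 1) := by
    rw [div_le_div_iff₀ (by positivity) (by positivity)]
    have : (n : ℝ) ≤ N := by exact_mod_cast hn
    nlinarith
  refine le_trans ?_ (mul_le_mul_of_nonneg_right hN hd)
  have hb : ∀ j, (barycenter : stdSimplex ℝ (Fin (n + 1))) j = (n + 1 : ℝ)⁻¹ := fun j => by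
    change (Fintype.card (Fin (n + 1)) : ℝ)⁻¹ = _
    simp
  have e : (tupleBarycenter n v : Fin m → ℝ) - v i =
      ∑ j, (n + 1 : ℝ)⁻¹ • ((v j : Fin m → ℝ) - v i) := by
    rw [tupleBarycenter, affineMap_coe]
    simp only [hb, smul_sub, Finset.sum_sub_distrib]
    congr 1
    rw [Finset.sum_const, Finset.card_univ, Fintype.card_fin, ← Nat.cast_smul_eq_nsmul ℝ,
      smul_smul]
    push_cast
    rw [mul_inv_cancel₀ (by positivity), one_smul]
  rw [dist_comm, Subtype.dist_eq, dist_eq_norm]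
  change ‖(tupleBarycenter n v : Fin m → ℝ) - v i‖ ≤ _
  rw [e, ← Finset.add_sum_erase _ _ (Finset.mem_univ i),
    sub_self, smul_zero, zero_add]
  refine (norm_sum_le_of_le _ (f := fun j => (n + 1 : ℝ)⁻¹ • ((v j : Fin m → ℝ) - v i))
    (n := fun _ => (n + 1 : ℝ)⁻¹ * d) fun j _ => ?_).trans ?_
  · rw [norm_smul, Real.norm_of_nonneg (by positivity), ← dist_eq_norm]
    exact mul_le_mul_of_nonneg_left (h j i) (by positivity)
  · rw [Finset.sum_const, Finset.card_erase_of_mem (Finset.mem_univ i), Finset.card_univ,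
      Fintype.card_fin, Nat.add_sub_cancel, nsmul_eq_mul]
    apply le_of_eq
    field_simp

end stdSimplex

/-- Singular chains of `X`, with the degree shifted by one: `SingularChain κ n X` is free on the
continuous maps from the standard simplex with `n` vertices. For `n = 0` that simplex is empty, so
these modules form the *augmented* singular chain complex of `X`. -/
abbrev SingularChain (κ : Type*) [Field κ] (n : ℕ) (X : Type*) [TopologicalSpace X] :=
  C(stdSimplex ℝ (Fin n), X) →₀ κ

namespace SingularChain

open stdSimplex

variable {κ : Type*} [Field κ] {X Y : Type*} [TopologicalSpace X] [TopologicalSpace Y]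

/-- The alternating sum of the faces of a singular simplex. -/
noncomputable def boundary (n : ℕ) : SingularChain κ (n + 1) X →ₗ[κ] SingularChain κ n X :=
  Finsupp.linearCombination κ fun σ => ∑ j : Fin (n + 1), (-1 : κ) ^ (j : ℕ) •
    Finsupp.single (σ.comp (affineMap (vertex ∘ j.succAbove))) 1

/-- The map on singular chains induced by a continuous map. -/
noncomputable def map (f : C(X, Y)) (n : ℕ) : SingularChain κ n X →ₗ[κ] SingularChain κ n Y :=
  Finsupp.lmapDomain κ κ f.comp

/-- The singular chain obtained from a chain of tuples in a standard simplex, seen as affine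
simplices, by composition with a singular simplex `σ`. -/
noncomputable def push {n : ℕ} (σ : C(stdSimplex ℝ (Fin n), X)) (m : ℕ) :
    TupleChain κ (stdSimplex ℝ (Fin n)) m →ₗ[κ] SingularChain κ m X :=
  Finsupp.lmapDomain κ κ fun v => σ.comp (affineMap v)

/-- The submodule of the singular chains of `X` all of whose simplices lie in `A`. -/
noncomputable def chainsIn (κ : Type*) [Field κ] (n : ℕ) (A : Set X) :
    Submodule κ (SingularChain κ n X) :=
  Finsupp.supported κ κ {σ | ∀ x, σ x ∈ A}

theorem boundary_single (n : ℕ) (σ : C(stdSimplex ℝ (Fin (n + 1)), X)) :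
    boundary n (Finsupp.single σ (1 : κ)) = ∑ j : Fin (n + 1), (-1 : κ) ^ (j : ℕ) •
      Finsupp.single (σ.comp (affineMap (vertex ∘ j.succAbove))) 1 := by
  simp [boundary]

@[simp]
theorem map_single (f : C(X, Y)) (n : ℕ) (σ : C(stdSimplex ℝ (Fin n), X)) (a : κ) :
    map f n (Finsupp.single σ a) = Finsupp.single (f.comp σ) a := by
  simp [map]

@[simp]
theorem push_single {n : ℕ} (σ : C(stdSimplex ℝ (Fin n), X)) (m : ℕ)
    (v : Fin m → stdSimplex ℝ (Fin n)) (a : κ) :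
    push σ m (Finsupp.single v a) = Finsupp.single (σ.comp (affineMap v)) a := by
  simp [push]

theorem push_vertex {n : ℕ} (σ : C(stdSimplex ℝ (Fin n), X)) :
    push σ n (Finsupp.single vertex (1 : κ)) = Finsupp.single σ 1 := by
  rw [push_single, affineMap_vertex_eq_id, ContinuousMap.comp_id]

theorem push_comp_affineMap {n m : ℕ} (σ : C(stdSimplex ℝ (Fin n), X))
    (v : Fin m → stdSimplex ℝ (Fin n)) (l : ℕ) (c : TupleChain κ (stdSimplex ℝ (Fin m)) l) :
    push (σ.comp (affineMap v)) l c = push σ l (TupleChain.map (affineMap v) l c) := by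
  have : push (σ.comp (affineMap v)) l =
      (push σ l ∘ₗ TupleChain.map (affineMap v) l : _ →ₗ[κ] SingularChain κ l X) := by
    ext1 w
    ext1
    simp [affineMap_comp, ContinuousMap.comp_assoc]
  exact LinearMap.congr_fun this c

theorem boundary_map (f : C(X, Y)) (n : ℕ) (c : SingularChain κ (n + 1) X) :
    boundary n (map f (n + 1) c) = map f n (boundary n c) := by
  have : boundary n ∘ₗ map f (n + 1) = (map f n ∘ₗ boundary n : _ →ₗ[κ] SingularChain κ n Y) := by
    ext1 σ
    ext1
    simp [boundary_single, ContinuousMap.comp_assoc]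
  exact LinearMap.congr_fun this c

theorem boundary_push {n : ℕ} (σ : C(stdSimplex ℝ (Fin n), X)) (m : ℕ)
    (c : TupleChain κ (stdSimplex ℝ (Fin n)) (m + 1)) :
    boundary m (push σ (m + 1) c) = push σ m (TupleChain.boundary m c) := by
  have : boundary m ∘ₗ push σ (m + 1) =
      (push σ m ∘ₗ TupleChain.boundary m : _ →ₗ[κ] SingularChain κ m X) := by
    ext1 v
    ext1
    simp [boundary_single, TupleChain.boundary_single, ContinuousMap.comp_assoc,
      ← affineMap_comp_reindex]
  exact LinearMap.congr_fun this c

theorem boundary_boundary (n : ℕ) (c : SingularChain κ (n + 2) X) :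
    boundary n (boundary (n + 1) c) = 0 := by
  have : boundary n ∘ₗ boundary (n + 1) = (0 : _ →ₗ[κ] SingularChain κ n X) := by
    ext1 σ
    ext1
    simp only [LinearMap.comp_apply, Finsupp.lsingle_apply, LinearMap.zero_apply]
    rw [← push_vertex, boundary_push, boundary_push, TupleChain.boundary_boundary, map_zero]
  exact LinearMap.congr_fun this c

/-- The `k`-fold barycentric subdivision of singular chains. -/
noncomputable def subdivision (k n : ℕ) : SingularChain κ n X →ₗ[κ] SingularChain κ n X :=
  Finsupp.linearCombination κ fun σ =>
    push σ n ((TupleChain.subdivision tupleBarycenter n ^ k) (Finsupp.single vertex 1))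

/-- The chain homotopy between the identity and the `k`-fold barycentric subdivision. -/
noncomputable def subdivisionHomotopy (k n : ℕ) :
    SingularChain κ n X →ₗ[κ] SingularChain κ (n + 1) X :=
  Finsupp.linearCombination κ fun σ =>
    push σ (n + 1) (TupleChain.iteratedHomotopy tupleBarycenter k n (Finsupp.single vertex 1))

theorem subdivision_single (k n : ℕ) (σ : C(stdSimplex ℝ (Fin n), X)) :
    subdivision k n (Finsupp.single σ (1 : κ)) =
      push σ n ((TupleChain.subdivision tupleBarycenter n ^ k) (Finsupp.single vertex 1)) := by
  simp [subdivision]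

theorem subdivisionHomotopy_single (k n : ℕ) (σ : C(stdSimplex ℝ (Fin n), X)) :
    subdivisionHomotopy k n (Finsupp.single σ (1 : κ)) =
      push σ (n + 1)
        (TupleChain.iteratedHomotopy tupleBarycenter k n (Finsupp.single vertex 1)) := by
  simp [subdivisionHomotopy]

theorem subdivision_push (k m : ℕ) {n : ℕ} (σ : C(stdSimplex ℝ (Fin n), X))
    (c : TupleChain κ (stdSimplex ℝ (Fin n)) m) :
    subdivision k m (push σ m c) =
      push σ m ((TupleChain.subdivision tupleBarycenter m ^ k) c) := by
  have : subdivision k m ∘ₗ push σ m =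
      (push σ m ∘ₗ TupleChain.subdivision tupleBarycenter m ^ k :
        _ →ₗ[κ] SingularChain κ m X) := by
    ext1 v
    ext1
    simp only [LinearMap.comp_apply, Finsupp.lsingle_apply, push_single, subdivision_single,
      push_comp_affineMap]
    rw [TupleChain.map_subdivision_pow (affineMap_tupleBarycenter v), TupleChain.map_single,
      affineMap_comp_vertex]
  exact LinearMap.congr_fun this c

theorem subdivisionHomotopy_push (k m : ℕ) {n : ℕ} (σ : C(stdSimplex ℝ (Fin n), X))
    (c : TupleChain κ (stdSimplex ℝ (Fin n)) m) :
    subdivisionHomotopy k m (push σ m c) =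
      push σ (m + 1) (TupleChain.iteratedHomotopy tupleBarycenter k m c) := by
  have : subdivisionHomotopy k m ∘ₗ push σ m =
      (push σ (m + 1) ∘ₗ TupleChain.iteratedHomotopy tupleBarycenter k m :
        _ →ₗ[κ] SingularChain κ (m + 1) X) := by
    ext1 v
    ext1
    simp only [LinearMap.comp_apply, Finsupp.lsingle_apply, push_single,
      subdivisionHomotopy_single, push_comp_affineMap]
    rw [TupleChain.map_iteratedHomotopy (affineMap_tupleBarycenter v), TupleChain.map_single,
      affineMap_comp_vertex]
  exact LinearMap.congr_fun this c

theorem boundary_subdivision (k n : ℕ) (c : SingularChain κ (n + 1) X) :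
    boundary n (subdivision k (n + 1) c) = subdivision k n (boundary n c) := by
  have : boundary n ∘ₗ subdivision k (n + 1) =
      (subdivision k n ∘ₗ boundary n : _ →ₗ[κ] SingularChain κ n X) := by
    ext1 σ
    ext1
    simp only [LinearMap.comp_apply, Finsupp.lsingle_apply]
    rw [← push_vertex, subdivision_push, boundary_push, boundary_push, subdivision_push,
      TupleChain.boundary_subdivision_pow]
  exact LinearMap.congr_fun this c

theorem boundary_subdivisionHomotopy (k n : ℕ) (c : SingularChain κ (n + 1) X) :
    boundary (n + 1) (subdivisionHomotopy k (n + 1) c) + subdivisionHomotopy k n (boundary n c) =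
      c - subdivision k (n + 1) c := by
  have : boundary (n + 1) ∘ₗ subdivisionHomotopy k (n + 1) + subdivisionHomotopy k n ∘ₗ boundary n =
      (LinearMap.id - subdivision k (n + 1) : _ →ₗ[κ] SingularChain κ (n + 1) X) := by
    ext1 σ
    ext1
    simp only [LinearMap.comp_apply, Finsupp.lsingle_apply, LinearMap.add_apply,
      LinearMap.sub_apply, LinearMap.id_apply]
    rw [← push_vertex, subdivision_push, boundary_push, subdivisionHomotopy_push, boundary_push,
      subdivisionHomotopy_push, ← map_add, ← map_sub, TupleChain.boundary_iteratedHomotopy]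
  exact LinearMap.congr_fun this c

theorem subdivisionHomotopy_zero_right (k : ℕ) (c : SingularChain κ 0 X) :
    subdivisionHomotopy k 0 c = 0 := by
  have : subdivisionHomotopy k 0 = (0 : _ →ₗ[κ] SingularChain κ 1 X) := by
    ext1 σ
    ext1
    simp [subdivisionHomotopy_single, TupleChain.iteratedHomotopy_zero_right]
  exact LinearMap.congr_fun this c

/-- A linear map takes the chains in `A` to a given submodule as soon as it does so for the
simplices in `A`. -/
theorem map_mem_of_mem_chainsIn {M : Type*} [AddCommGroup M] [Module κ M] {n : ℕ} {A : Set X}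
    (φ : SingularChain κ n X →ₗ[κ] M) {N : Submodule κ M}
    (h : ∀ σ : C(stdSimplex ℝ (Fin n), X), (∀ x, σ x ∈ A) → φ (Finsupp.single σ 1) ∈ N)
    {c : SingularChain κ n X} (hc : c ∈ chainsIn κ n A) : φ c ∈ N := by
  rw [chainsIn, Finsupp.supported_eq_span_single] at hc
  refine (Submodule.span_le (p := N.comap φ)).2 ?_ hc
  rintro _ ⟨σ, hσ, rfl⟩
  exact h σ hσ

theorem single_mem_chainsIn {n : ℕ} {A : Set X} {σ : C(stdSimplex ℝ (Fin n), X)}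
    (h : ∀ x, σ x ∈ A) (a : κ) : Finsupp.single σ a ∈ chainsIn κ n A :=
  Finsupp.single_mem_supported κ a h

theorem boundary_mem_chainsIn {n : ℕ} {A : Set X} {c : SingularChain κ (n + 1) X}
    (hc : c ∈ chainsIn κ (n + 1) A) : boundary n c ∈ chainsIn κ n A := by
  refine map_mem_of_mem_chainsIn _ (fun σ hσ => ?_) hc
  rw [boundary_single]
  exact Submodule.sum_mem _ fun j _ => Submodule.smul_mem _ _
    (single_mem_chainsIn (σ := σ.comp _) (fun x => hσ _) (1 : κ))

theorem push_mem_chainsIn {n m : ℕ} {A : Set X} {σ : C(stdSimplex ℝ (Fin n), X)}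
    (h : ∀ x, σ x ∈ A) (c : TupleChain κ (stdSimplex ℝ (Fin n)) m) :
    push σ m c ∈ chainsIn κ m A := by
  induction c using Finsupp.induction_linear with
  | zero => simp
  | add c d hc hd => rw [map_add]; exact Submodule.add_mem _ hc hd
  | single v a => rw [push_single]; exact single_mem_chainsIn (σ := σ.comp _) (fun x => h _) a

theorem subdivision_mem_chainsIn {k n : ℕ} {A : Set X} {c : SingularChain κ n X}
    (hc : c ∈ chainsIn κ n A) : subdivision k n c ∈ chainsIn κ n A := by
  refine map_mem_of_mem_chainsIn _ (fun σ hσ => ?_) hc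
  rw [subdivision_single]
  exact push_mem_chainsIn hσ _

theorem subdivisionHomotopy_mem_chainsIn {k n : ℕ} {A : Set X} {c : SingularChain κ n X}
    (hc : c ∈ chainsIn κ n A) : subdivisionHomotopy k n c ∈ chainsIn κ (n + 1) A := by
  refine map_mem_of_mem_chainsIn _ (fun σ hσ => ?_) hc
  rw [subdivisionHomotopy_single]
  exact push_mem_chainsIn hσ _

theorem chainsIn_inf (n : ℕ) (A B : Set X) :
    chainsIn κ n A ⊓ chainsIn κ n B = chainsIn κ n (A ∩ B) := by
  rw [chainsIn, chainsIn, ← Finsupp.supported_inter, chainsIn]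
  congr 1
  ext σ
  exact forall_and.symm

/-- The simplices of a sufficiently fine subdivision of a standard simplex are small. -/
theorem exists_subdivision_mem_supported (κ : Type*) [Field κ] (n : ℕ) {ε : ℝ} (hε : 0 < ε) :
    ∃ K, ∀ k ≥ K, (TupleChain.subdivision tupleBarycenter n ^ k)
      (Finsupp.single (vertex : Fin n → stdSimplex ℝ (Fin n)) (1 : κ)) ∈
        Finsupp.supported κ κ {v | ∀ i j, dist (v i) (v j) < ε} := by
  have hq₀ : (0 : ℝ) ≤ n / (n + 1) := by positivity
  have hq₁ : (n / (n + 1) : ℝ) < 1 := by rw [div_lt_one (by positivity)]; linarith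
  have hlim : Filter.Tendsto (fun k : ℕ => (n / (n + 1) : ℝ) ^ k * 1) Filter.atTop (𝓝 (0 * 1)) :=
    (tendsto_pow_atTop_nhds_zero_of_lt_one hq₀ hq₁).mul_const 1
  rw [zero_mul] at hlim
  obtain ⟨K, hK⟩ := Filter.eventually_atTop.1 (hlim.eventually (gt_mem_nhds hε))
  refine ⟨K, fun k hk => ?_⟩
  have h := TupleChain.subdivision_pow_mem_supported_dist_le (κ := κ) (N := n)
    (β := tupleBarycenter (m := n)) (q := n / (n + 1)) (fun m v u e h => dist_affineMap_le h _)
    hq₀ (fun m v d hm h i => dist_tupleBarycenter_le v hm h i) (Nat.le_succ n) zero_le_one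
    (c := Finsupp.single vertex 1) (Finsupp.single_mem_supported κ _ fun i j =>
      (Metric.dist_le_diam_of_mem (bounded_stdSimplex (Fin n)) (vertex i).2 (vertex j).2).trans
        diam_stdSimplex_le) k
  exact Finsupp.supported_mono (fun v hv i j => (hv i j).trans_lt (hK k hk)) h

/-- **Small simplices**: if the sets `O₁` and `O₂` are relatively open in their union, then every
chain in `O₁ ∪ O₂` becomes a sum of a chain in `O₁` and a chain in `O₂` after sufficiently many
subdivisions. -/
theorem exists_subdivision_mem_sup {n : ℕ} {O₁ O₂ U₁ U₂ : Set X} (hU₁ : IsOpen U₁) (hU₂ : IsOpen U₂)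
    (h₁ : (O₁ ∪ O₂) ∩ U₁ = O₁) (h₂ : (O₁ ∪ O₂) ∩ U₂ = O₂) {c : SingularChain κ n X}
    (hc : c ∈ chainsIn κ n (O₁ ∪ O₂)) :
    ∃ k, subdivision k n c ∈ chainsIn κ n O₁ ⊔ chainsIn κ n O₂ := by
  suffices H : ∃ K, ∀ k ≥ K, subdivision k n c ∈ chainsIn κ n O₁ ⊔ chainsIn κ n O₂ from
    H.imp fun K hK => hK K le_rfl
  rw [chainsIn, Finsupp.supported_eq_span_single] at hc
  induction hc using Submodule.span_induction with
  | zero => exact ⟨0, fun k _ => by simp⟩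
  | add c d _ _ hc hd =>
    obtain ⟨K, hK⟩ := hc
    obtain ⟨L, hL⟩ := hd
    refine ⟨max K L, fun k hk => ?_⟩
    rw [map_add]
    exact Submodule.add_mem _ (hK k (le_of_max_le_left hk)) (hL k (le_of_max_le_right hk))
  | smul a c _ hc =>
    obtain ⟨K, hK⟩ := hc
    refine ⟨K, fun k hk => ?_⟩
    rw [map_smul]
    exact Submodule.smul_mem _ a (hK k hk)
  | mem c hc =>
    obtain ⟨σ, hσ, rfl⟩ := hc
    obtain ⟨δ, hδ, hleb⟩ := lebesgue_number_lemma_of_metric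
      (s := (univ : Set (stdSimplex ℝ (Fin n))))
      (c := fun b : Bool => σ ⁻¹' (if b then U₁ else U₂)) isCompact_univ
      (fun b => by
        cases b
        · exact hU₂.preimage σ.continuous
        · exact hU₁.preimage σ.continuous)
      (fun x _ => by
        rcases hσ x with hx | hx
        · exact mem_iUnion.2 ⟨true, (h₁.ge hx).2⟩
        · exact mem_iUnion.2 ⟨false, (h₂.ge hx).2⟩)
    obtain ⟨K, hK⟩ := exists_subdivision_mem_supported κ n (half_pos hδ)
    refine ⟨K, fun k hk => ?_⟩
    change subdivision k n (Finsupp.single σ 1) ∈ _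
    rw [subdivision_single]
    have hk := hK k hk
    rw [Finsupp.supported_eq_span_single] at hk
    refine (Submodule.span_le (p := (chainsIn κ n O₁ ⊔ chainsIn κ n O₂).comap (push σ n))).2 ?_ hk
    rintro _ ⟨v, hv, rfl⟩
    change push σ n (Finsupp.single v (1 : κ)) ∈ chainsIn κ n O₁ ⊔ chainsIn κ n O₂
    rw [push_single]
    -- an affine simplex with one vertex `v i` lies in a ball around that vertex
    have hball : ∀ i x, affineMap v x ∈ Metric.ball (v i) δ := fun i x =>
      (dist_affineMap_le (fun j => (hv j i).le) x).trans_lt (half_lt_self hδ)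
    rcases isEmpty_or_nonempty (Fin n) with hn | ⟨⟨i⟩⟩
    · refine Submodule.mem_sup_left (single_mem_chainsIn (fun x => ?_) 1)
      exact ((stdSimplex_of_isEmpty_index ℝ (Fin n)).le x.2).elim
    · obtain ⟨b, hb⟩ := hleb (v i) (mem_univ _)
      cases b
      · exact Submodule.mem_sup_right (single_mem_chainsIn (σ := σ.comp _)
          (fun x => h₂.le ⟨hσ _, hb (hball i x)⟩) 1)
      · exact Submodule.mem_sup_left (single_mem_chainsIn (σ := σ.comp _)
          (fun x => h₁.le ⟨hσ _, hb (hball i x)⟩) 1)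

/-- Chains in a subset are images of chains of the subspace. -/
theorem exists_map_eq_of_mem_chainsIn {n : ℕ} {A : Set X} {c : SingularChain κ n X}
    (hc : c ∈ chainsIn κ n A) :
    ∃ d : SingularChain κ n A, map ⟨Subtype.val, continuous_subtype_val⟩ n d = c := by
  refine map_mem_of_mem_chainsIn (N := LinearMap.range
    (map (⟨Subtype.val, continuous_subtype_val⟩ : C(A, X)) n)) LinearMap.id (fun σ hσ => ?_) hc
  refine ⟨Finsupp.single ⟨fun x => ⟨σ x, hσ x⟩, by fun_prop⟩ 1, ?_⟩
  rw [map_single]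
  rfl

theorem map_subtype_mem_chainsIn {n : ℕ} {A : Set X} (d : SingularChain κ n A) :
    map ⟨Subtype.val, continuous_subtype_val⟩ n d ∈ chainsIn κ n A := by
  induction d using Finsupp.induction_linear with
  | zero => simp
  | add c d hc hd => rw [map_add]; exact Submodule.add_mem _ hc hd
  | single σ a => rw [map_single]; exact single_mem_chainsIn (fun x => (σ x).2) a

theorem map_subtype_injective (n : ℕ) (A : Set X) :
    Function.Injective (map (κ := κ) (⟨Subtype.val, continuous_subtype_val⟩ : C(A, X)) n) :=
  Finsupp.mapDomain_injective fun _ _ h => ContinuousMap.ext fun x =>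
    Subtype.ext (DFunLike.congr_fun h x)

theorem map_map {Z : Type*} [TopologicalSpace Z] (g : C(Y, Z)) (f : C(X, Y)) (n : ℕ)
    (c : SingularChain κ n X) : map g n (map f n c) = map (g.comp f) n c := by
  have : map g n ∘ₗ map f n = (map (g.comp f) n : _ →ₗ[κ] SingularChain κ n Z) := by
    ext1 σ
    ext1
    simp [ContinuousMap.comp_assoc]
  exact LinearMap.congr_fun this c

end SingularChain

/-! ### Singular homology classes of cycles -/

namespace SingularChain

open CategoryTheory Limits stdSimplex AlgebraicTopology

variable {κ : Type u} [Field κ] {X Y Z : Type u} [TopologicalSpace X] [TopologicalSpace Y]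
  [TopologicalSpace Z]

/-- The simplices of the singular simplicial set of `Y` as continuous maps. -/
noncomputable def simplexEquiv (Y : Type u) [TopologicalSpace Y] (n : ℕ) :
    (TopCat.toSSet.obj (TopCat.of Y)).obj (.op (.mk n)) ≃ C(stdSimplex ℝ (Fin (n + 1)), Y) :=
  (TopCat.of Y).toSSetObjEquiv (.op (.mk n))

theorem simplexEquiv_δ (n : ℕ) (j : Fin (n + 2))
    (x : (TopCat.toSSet.obj (TopCat.of Y)).obj (.op (.mk (n + 1)))) :
    simplexEquiv Y n ((TopCat.toSSet.obj (TopCat.of Y)).δ j x) =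
      (simplexEquiv Y (n + 1) x).comp (affineMap (vertex ∘ j.succAbove)) := by
  ext1 y
  rw [ContinuousMap.comp_apply, affineMap_vertex_reindex]
  rfl

theorem simplexEquiv_map (f : C(X, Y)) (n : ℕ)
    (x : (TopCat.toSSet.obj (TopCat.of X)).obj (.op (.mk n))) :
    simplexEquiv Y n ((TopCat.toSSet.map (TopCat.ofHom f)).app _ x) =
      f.comp (simplexEquiv X n x) := rfl

/-- The singular chain complex of `Y` with coefficients in `κ`. -/
noncomputable abbrev complex (κ : Type u) [Field κ] (Y : Type u) [TopologicalSpace Y] :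
    ChainComplex (ModuleCat.{u} κ) ℕ :=
  (TopCat.toSSet.obj (TopCat.of Y)).chainComplex (ModuleCat.of κ κ)

/-- The comparison of singular chains with the terms of the singular chain complex. -/
noncomputable def toComplex (κ : Type u) [Field κ] (Y : Type u) [TopologicalSpace Y] (n : ℕ) :
    SingularChain κ (n + 1) Y →ₗ[κ] (complex κ Y).X n :=
  Finsupp.linearCombination κ fun σ =>
    (SSet.ιChainComplex (TopCat.toSSet.obj (TopCat.of Y)) (R := ModuleCat.of κ κ)
      ((simplexEquiv Y n).symm σ)).hom (1 : κ)

/-- The inverse of `toComplex`. -/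
noncomputable def ofComplex (κ : Type u) [Field κ] (Y : Type u) [TopologicalSpace Y] (n : ℕ) :
    (complex κ Y).X n →ₗ[κ] SingularChain κ (n + 1) Y :=
  ((SSet.isColimitChainComplexXCofan (TopCat.toSSet.obj (TopCat.of Y)) (ModuleCat.of κ κ) n).desc
    (Cofan.mk (ModuleCat.of κ (SingularChain κ (n + 1) Y))
      fun x => ModuleCat.ofHom (Finsupp.lsingle (simplexEquiv Y n x)))).hom

theorem ofComplex_ι (n : ℕ) (x : (TopCat.toSSet.obj (TopCat.of Y)).obj (.op (.mk n))) :
    ofComplex κ Y n ((SSet.ιChainComplex (TopCat.toSSet.obj (TopCat.of Y))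
      (R := ModuleCat.of κ κ) x).hom (1 : κ)) = Finsupp.single (simplexEquiv Y n x) 1 :=
  congr(($((SSet.isColimitChainComplexXCofan (TopCat.toSSet.obj (TopCat.of Y))
    (ModuleCat.of κ κ) n).fac (Cofan.mk (ModuleCat.of κ (SingularChain κ (n + 1) Y))
      fun x => ModuleCat.ofHom (Finsupp.lsingle (simplexEquiv Y n x))) ⟨x⟩)).hom (1 : κ))

theorem toComplex_single (n : ℕ) (σ : C(stdSimplex ℝ (Fin (n + 1)), Y)) :
    toComplex κ Y n (Finsupp.single σ 1) =
      (SSet.ιChainComplex (TopCat.toSSet.obj (TopCat.of Y)) (R := ModuleCat.of κ κ)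
        ((simplexEquiv Y n).symm σ)).hom (1 : κ) :=
  (Finsupp.linearCombination_single κ _ _).trans (one_smul _ _)

theorem ofComplex_toComplex (n : ℕ) (c : SingularChain κ (n + 1) Y) :
    ofComplex κ Y n (toComplex κ Y n c) = c := by
  have : ofComplex κ Y n ∘ₗ toComplex κ Y n = LinearMap.id := by
    ext1 σ
    ext1
    rw [LinearMap.comp_apply, LinearMap.comp_apply, Finsupp.lsingle_apply, toComplex_single,
      ofComplex_ι, Equiv.apply_symm_apply]
    rfl
  exact LinearMap.congr_fun this c

theorem toComplex_ofComplex (n : ℕ) (y : (complex κ Y).X n) :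
    toComplex κ Y n (ofComplex κ Y n y) = y := by
  have : ModuleCat.ofHom (toComplex κ Y n ∘ₗ ofComplex κ Y n) = 𝟙 ((complex κ Y).X n) := by
    refine SSet.chainComplex_hom_ext fun x => ?_
    rw [Category.comp_id]
    ext1
    refine LinearMap.ext_ring ?_
    refine (congrArg (toComplex κ Y n) (ofComplex_ι n x)).trans ?_
    rw [toComplex_single, Equiv.symm_apply_apply]
  exact congr(($this).hom y)

theorem toComplex_injective (n : ℕ) : Function.Injective (toComplex κ Y n) :=
  Function.LeftInverse.injective (ofComplex_toComplex n)

theorem d_toComplex (n : ℕ) (c : SingularChain κ (n + 2) Y) :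
    ((complex κ Y).d (n + 1) n).hom (toComplex κ Y (n + 1) c) =
      toComplex κ Y n (boundary (n + 1) c) := by
  have : ((complex κ Y).d (n + 1) n).hom ∘ₗ toComplex κ Y (n + 1) =
      toComplex κ Y n ∘ₗ boundary (n + 1) := by
    ext1 σ
    ext1
    have hδ : ∀ j, (TopCat.toSSet.obj (TopCat.of Y)).δ j ((simplexEquiv Y (n + 1)).symm σ) =
        (simplexEquiv Y n).symm (σ.comp (affineMap (vertex ∘ j.succAbove))) := fun j => by
      rw [Equiv.eq_symm_apply, simplexEquiv_δ, Equiv.apply_symm_apply]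
    rw [LinearMap.comp_apply, LinearMap.comp_apply, Finsupp.lsingle_apply, toComplex_single,
      LinearMap.comp_apply, LinearMap.comp_apply, Finsupp.lsingle_apply, boundary_single, map_sum]
    refine (congr(($(SSet.ιChainComplex_d (TopCat.toSSet.obj (TopCat.of Y))
      (R := ModuleCat.of κ κ) ((simplexEquiv Y (n + 1)).symm σ))).hom (1 : κ))).trans ?_
    rw [ModuleCat.hom_sum, LinearMap.sum_apply]
    refine Finset.sum_congr rfl fun j _ => ?_
    rw [map_smul, toComplex_single, hδ]
    rcases Nat.even_or_odd (j : ℕ) with h | h <;> simp [h.neg_one_pow]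
  exact LinearMap.congr_fun this c

theorem chainComplexMap_toComplex (f : C(X, Y)) (n : ℕ) (c : SingularChain κ (n + 1) X) :
    ((SSet.chainComplexMap (TopCat.toSSet.map (TopCat.ofHom f)) (ModuleCat.of κ κ)).f n).hom
      (toComplex κ X n c) = toComplex κ Y n (map f (n + 1) c) := by
  have : ((SSet.chainComplexMap (TopCat.toSSet.map (TopCat.ofHom f)) (ModuleCat.of κ κ)).f n).hom ∘ₗ
      toComplex κ X n = toComplex κ Y n ∘ₗ map f (n + 1) := by
    ext1 σ
    ext1
    have hm : (TopCat.toSSet.map (TopCat.ofHom f)).app _ ((simplexEquiv X n).symm σ) =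
        (simplexEquiv Y n).symm (f.comp σ) := by
      rw [Equiv.eq_symm_apply, simplexEquiv_map, Equiv.apply_symm_apply]
    rw [LinearMap.comp_apply, LinearMap.comp_apply, Finsupp.lsingle_apply, toComplex_single,
      LinearMap.comp_apply, LinearMap.comp_apply, Finsupp.lsingle_apply, map_single,
      toComplex_single, ← hm]
    exact congr(($(SSet.ι_chainComplexMap_f _ _ (R := ModuleCat.of κ κ)
      (TopCat.toSSet.map (TopCat.ofHom f)) ((simplexEquiv X n).symm σ))).hom (1 : κ))
  exact LinearMap.congr_fun this c

/-- The boundary map out of degree `r` in the unaugmented singular chain complex. -/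
noncomputable def differential (κ : Type u) [Field κ] (Y : Type u) [TopologicalSpace Y] :
    ∀ r, SingularChain κ (r + 1) Y →ₗ[κ] SingularChain κ r Y
  | 0 => 0
  | r + 1 => boundary (r + 1)

/-- The singular `r`-cycles. -/
noncomputable abbrev cycles (κ : Type u) [Field κ] (Y : Type u) [TopologicalSpace Y] (r : ℕ) :
    Submodule κ (SingularChain κ (r + 1) Y) :=
  LinearMap.ker (differential κ Y r)

/-- The inclusion of the singular cycles into the singular chain complex. -/
noncomputable def cyclesHom (κ : Type u) [Field κ] (Y : Type u) [TopologicalSpace Y] (r : ℕ) :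
    ModuleCat.of κ (cycles κ Y r) ⟶ (complex κ Y).X r :=
  ModuleCat.ofHom (X := cycles κ Y r) (Y := (complex κ Y).X r)
    (toComplex κ Y r ∘ₗ (cycles κ Y r).subtype)

theorem cyclesHom_d (r : ℕ) :
    cyclesHom κ Y r ≫ (complex κ Y).d r ((ComplexShape.down ℕ).next r) = 0 := by
  cases r with
  | zero => rw [HomologicalComplex.shape _ _ _ (by simp), comp_zero]
  | succ r =>
    rw [ChainComplex.next_nat_succ]
    ext1
    ext1 z
    refine (d_toComplex r z.1).trans ?_
    rw [show boundary (r + 1) z.1 = 0 from z.2, map_zero]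
    rfl

/-- The morphism from the singular cycles to the cycles of the singular chain complex. -/
noncomputable def toCycles (κ : Type u) [Field κ] (Y : Type u) [TopologicalSpace Y] (r : ℕ) :
    ModuleCat.of κ (cycles κ Y r) ⟶ (complex κ Y).cycles r :=
  (complex κ Y).liftCycles (cyclesHom κ Y r) _ rfl (cyclesHom_d r)

theorem iCycles_toCycles (r : ℕ) (z : cycles κ Y r) :
    ((complex κ Y).iCycles r).hom ((toCycles κ Y r).hom z) = toComplex κ Y r z :=
  congr(($((complex κ Y).liftCycles_i (cyclesHom κ Y r) _ rfl (cyclesHom_d r))).hom z)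

theorem iCycles_injective (r : ℕ) : Function.Injective ((complex κ Y).iCycles r).hom :=
  (ModuleCat.mono_iff_injective ((complex κ Y).iCycles r)).1 inferInstance

/-- The homology class of a singular cycle. -/
noncomputable def homologyClass (κ : Type u) [Field κ] (Y : Type u) [TopologicalSpace Y] (r : ℕ) :
    cycles κ Y r →ₗ[κ] singularHomology κ r Y :=
  (toCycles κ Y r ≫ (complex κ Y).homologyπ r).hom

theorem homologyClass_surjective (r : ℕ) : Function.Surjective (homologyClass κ Y r) := by
  intro a
  obtain ⟨y, rfl⟩ := (ModuleCat.epi_iff_surjective ((complex κ Y).homologyπ r)).1 inferInstance a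
  have hcy := toComplex_ofComplex r (((complex κ Y).iCycles r).hom y)
  set c := ofComplex κ Y r (((complex κ Y).iCycles r).hom y) with hc
  have hz : c ∈ cycles κ Y r := by
    rw [LinearMap.mem_ker]
    cases r with
    | zero => rfl
    | succ r =>
      apply toComplex_injective
      refine (d_toComplex r c).symm.trans ?_
      rw [hcy, map_zero]
      exact congr(($((complex κ Y).iCycles_d (r + 1) r)).hom y)
  refine ⟨⟨c, hz⟩, ?_⟩
  change ((complex κ Y).homologyπ r).hom ((toCycles κ Y r).hom ⟨c, hz⟩) = _
  have : (toCycles κ Y r).hom ⟨c, hz⟩ = y :=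
    iCycles_injective r ((iCycles_toCycles r ⟨c, hz⟩).trans hcy)
  rw [this]

theorem homologyClass_eq_zero_iff (r : ℕ) (z : cycles κ Y r) :
    homologyClass κ Y r z = 0 ↔ ∃ e : SingularChain κ (r + 2) Y, boundary (r + 1) e = z := by
  have hex : (ShortComplex.mk _ _ ((complex κ Y).toCycles_comp_homologyπ (r + 1) r)).Exact :=
    ShortComplex.exact_of_g_is_cokernel _ ((complex κ Y).homologyIsCokernel (r + 1) r (by simp))
  rw [ShortComplex.moduleCat_exact_iff] at hex
  have hd : ∀ e, ((complex κ Y).iCycles r).hom (((complex κ Y).toCycles (r + 1) r).hom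
      (toComplex κ Y (r + 1) e)) = toComplex κ Y r (boundary (r + 1) e) := fun e =>
    (congr(($((complex κ Y).toCycles_i (r + 1) r)).hom (toComplex κ Y (r + 1) e))).trans
      (d_toComplex r e)
  constructor
  · intro h
    obtain ⟨y, hy⟩ := hex ((toCycles κ Y r).hom z) h
    refine ⟨ofComplex κ Y (r + 1) y, toComplex_injective r ?_⟩
    rw [← hd, toComplex_ofComplex, ← iCycles_toCycles]
    exact congrArg _ hy
  · rintro ⟨e, he⟩
    have : (toCycles κ Y r).hom z =
        ((complex κ Y).toCycles (r + 1) r).hom (toComplex κ Y (r + 1) e) := by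
      apply iCycles_injective
      rw [hd, he]
      exact iCycles_toCycles r z
    change ((complex κ Y).homologyπ r).hom ((toCycles κ Y r).hom z) = 0
    rw [this]
    exact congr(($((complex κ Y).toCycles_comp_homologyπ (r + 1) r)).hom _)

theorem differential_boundary (r : ℕ) (c : SingularChain κ (r + 2) X) :
    differential κ X r (boundary (r + 1) c) = 0 := by
  cases r with
  | zero => rfl
  | succ r => exact boundary_boundary _ c

theorem differential_subdivision (k r : ℕ) (c : SingularChain κ (r + 1) X) :
    differential κ X r (subdivision k (r + 1) c) = subdivision k r (differential κ X r c) := by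
  cases r with
  | zero => exact (map_zero _).symm
  | succ r => exact boundary_subdivision k (r + 1) c

theorem differential_map (f : C(X, Y)) (r : ℕ) (c : SingularChain κ (r + 1) X) :
    differential κ Y r (map f (r + 1) c) = map f r (differential κ X r c) := by
  cases r with
  | zero => exact (map_zero _).symm
  | succ r => exact boundary_map f (r + 1) c

/-- A cycle is homologous to its subdivisions. -/
theorem boundary_subdivisionHomotopy_of_mem_cycles (k : ℕ) {r : ℕ} {z : SingularChain κ (r + 1) X}
    (hz : z ∈ cycles κ X r) :
    boundary (r + 1) (subdivisionHomotopy k (r + 1) z) = z - subdivision k (r + 1) z := by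
  rw [← boundary_subdivisionHomotopy]
  cases r with
  | zero => rw [subdivisionHomotopy_zero_right, add_zero]
  | succ r =>
    have : boundary (r + 1) z = 0 := hz
    rw [this, map_zero, add_zero]

/-- Two cycles of a subspace are homologous if their difference bounds a chain of the ambient space
which lies in the subspace. -/
theorem homologyClass_eq_of_boundary {A : Set X} {r : ℕ} (z z' : cycles κ A r)
    {w : SingularChain κ (r + 2) X} (hw : w ∈ chainsIn κ (r + 2) A)
    (h : boundary (r + 1) w = map ⟨Subtype.val, continuous_subtype_val⟩ (r + 1) z.1 -
      map ⟨Subtype.val, continuous_subtype_val⟩ (r + 1) z'.1) :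
    homologyClass κ A r z = homologyClass κ A r z' := by
  obtain ⟨w', rfl⟩ := exists_map_eq_of_mem_chainsIn hw
  rw [← sub_eq_zero, ← map_sub, homologyClass_eq_zero_iff]
  refine ⟨w', map_subtype_injective _ _ ?_⟩
  rw [← boundary_map, h, ← map_sub]
  rfl

theorem map_mem_cycles (f : C(X, Y)) {r : ℕ} {z : SingularChain κ (r + 1) X}
    (hz : z ∈ cycles κ X r) : map f (r + 1) z ∈ cycles κ Y r := by
  rw [LinearMap.mem_ker] at hz ⊢
  rw [differential_map, hz, map_zero]

end SingularChain

open SingularChain CategoryTheory in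
/-- The linear map which a continuous map induces in singular homology. -/
noncomputable def singularHomologyMap (κ : Type u) [Field κ] (r : ℕ) {X Y : Type u}
    [TopologicalSpace X] [TopologicalSpace Y] (f : C(X, Y)) :
    singularHomology κ r X →ₗ[κ] singularHomology κ r Y :=
  (((AlgebraicTopology.singularHomologyFunctor (ModuleCat.{u} κ) r).obj (ModuleCat.of κ κ)).map
    (TopCat.ofHom f)).hom

section

open SingularChain CategoryTheory

variable {κ : Type u} [Field κ] {X Y Z : Type u} [TopologicalSpace X] [TopologicalSpace Y]
  [TopologicalSpace Z]

theorem singularHomologyMap_homologyClass (f : C(X, Y)) (r : ℕ) (z : cycles κ X r) :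
    singularHomologyMap κ r f (homologyClass κ X r z) =
      homologyClass κ Y r ⟨map f (r + 1) z, map_mem_cycles f z.2⟩ := by
  let φ := SSet.chainComplexMap (TopCat.toSSet.map (TopCat.ofHom f)) (ModuleCat.of κ κ)
  have h : (HomologicalComplex.cyclesMap φ r).hom ((toCycles κ X r).hom z) =
      (toCycles κ Y r).hom ⟨map f (r + 1) z, map_mem_cycles f z.2⟩ := by
    apply iCycles_injective
    refine (congr(($(HomologicalComplex.cyclesMap_i φ r)).hom ((toCycles κ X r).hom z))).trans ?_
    refine Eq.trans ?_ (iCycles_toCycles r _).symm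
    exact (congrArg (φ.f r).hom (iCycles_toCycles r z)).trans (chainComplexMap_toComplex f r z.1)
  exact (congr(($(HomologicalComplex.homologyπ_naturality φ r)).hom
    ((toCycles κ X r).hom z))).trans (congrArg ((complex κ Y).homologyπ r).hom h)

theorem singularHomologyMap_comp (r : ℕ) (g : C(Y, Z)) (f : C(X, Y))
    (a : singularHomology κ r X) :
    singularHomologyMap κ r g (singularHomologyMap κ r f a) =
      singularHomologyMap κ r (g.comp f) a := by
  have := ((AlgebraicTopology.singularHomologyFunctor (ModuleCat.{u} κ) r).obj
    (ModuleCat.of κ κ)).map_comp (TopCat.ofHom f) (TopCat.ofHom g)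
  exact (congr(($this).hom a)).symm

theorem singularHomologyMap_id (r : ℕ) (a : singularHomology κ r X) :
    singularHomologyMap κ r (ContinuousMap.id X) a = a := by
  have := ((AlgebraicTopology.singularHomologyFunctor (ModuleCat.{u} κ) r).obj
    (ModuleCat.of κ κ)).map_id (TopCat.of X)
  exact congr(($this).hom a)

theorem singularHomologyMap_eq_of_homotopy (r : ℕ) {f g : C(X, Y)} (H : f.Homotopy g) :
    singularHomologyMap κ r f = singularHomologyMap κ r g := by
  have H' : TopCat.Homotopy (TopCat.ofHom f) (TopCat.ofHom g) := H
  have := H'.congr_homologyMap_singularChainComplexFunctor (ModuleCat.of κ κ) r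
  exact congr(($this).hom)

theorem singularHomology_subsingleton_of_isEmpty (r : ℕ) [IsEmpty X] :
    Subsingleton (singularHomology κ r X) := by
  have : IsEmpty C(stdSimplex ℝ (Fin (r + 1)), X) :=
    ⟨fun σ => isEmptyElim (σ (stdSimplex.vertex 0))⟩
  exact (homologyClass_surjective r).subsingleton

/-- **Mayer–Vietoris**: if two subsets are relatively open in their union and a class of the first
and a class of the second agree in the union, then they come from one class of the intersection. -/
theorem exists_singularHomologyInclusion_eq (r : ℕ) {O₁ O₂ U₁ U₂ : Set X} (hU₁ : IsOpen U₁)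
    (hU₂ : IsOpen U₂) (h₁ : (O₁ ∪ O₂) ∩ U₁ = O₁) (h₂ : (O₁ ∪ O₂) ∩ U₂ = O₂)
    (a : singularHomology κ r O₁) (b : singularHomology κ r O₂)
    (hab : singularHomologyInclusion κ r subset_union_left a =
      singularHomologyInclusion κ r (subset_union_right (s := O₁)) b) :
    ∃ c : singularHomology κ r (O₁ ∩ O₂ : Set X),
      singularHomologyInclusion κ r inter_subset_left c = a ∧
      singularHomologyInclusion κ r inter_subset_right c = b := by
  obtain ⟨⟨a, ha⟩, rfl⟩ := homologyClass_surjective r a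
  obtain ⟨⟨b, hb⟩, rfl⟩ := homologyClass_surjective r b
  let j (A : Set X) : C(A, X) := ⟨Subtype.val, continuous_subtype_val⟩
  let i₁ : C(O₁, (O₁ ∪ O₂ : Set X)) := ⟨_, continuous_inclusion subset_union_left⟩
  let i₂ : C(O₂, (O₁ ∪ O₂ : Set X)) := ⟨_, continuous_inclusion subset_union_right⟩
  obtain ⟨e, he⟩ : ∃ e, boundary (r + 1) e = map i₁ (r + 1) a - map i₂ (r + 1) b := by
    have := sub_eq_zero.2 ((singularHomologyMap_homologyClass i₁ r ⟨a, ha⟩).symm.trans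
      (hab.trans (singularHomologyMap_homologyClass i₂ r ⟨b, hb⟩)))
    rw [← map_sub, homologyClass_eq_zero_iff] at this
    exact this
  have he' : boundary (r + 1) (map (j (O₁ ∪ O₂)) (r + 2) e) =
      map (j O₁) (r + 1) a - map (j O₂) (r + 1) b := by
    rw [boundary_map, he, map_sub, map_map, map_map]
    rfl
  obtain ⟨k, hk⟩ := exists_subdivision_mem_sup hU₁ hU₂ h₁ h₂
    (map_subtype_mem_chainsIn e : map (j (O₁ ∪ O₂)) (r + 2) e ∈ _)
  obtain ⟨e₁, he₁, e₂, he₂, hsum⟩ := Submodule.mem_sup.1 hk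
  have hja : map (j O₁) (r + 1) a ∈ cycles κ X r := map_mem_cycles _ ha
  have hjb : map (j O₂) (r + 1) b ∈ cycles κ X r := map_mem_cycles _ hb
  -- the boundary of the subdivided chain `e₁ + e₂` yields one chain lying in both subsets
  have hc : subdivision k (r + 1) (map (j O₁) (r + 1) a) - boundary (r + 1) e₁ =
      subdivision k (r + 1) (map (j O₂) (r + 1) b) + boundary (r + 1) e₂ := by
    rw [sub_eq_iff_eq_add, add_assoc, ← map_add, add_comm e₂, hsum, boundary_subdivision, he',
      map_sub]
    abel
  obtain ⟨c, hc'⟩ := exists_map_eq_of_mem_chainsIn (A := O₁ ∩ O₂)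
    (c := subdivision k (r + 1) (map (j O₁) (r + 1) a) - boundary (r + 1) e₁) (by
      rw [← chainsIn_inf]
      refine ⟨?_, ?_⟩
      · exact Submodule.sub_mem _ (subdivision_mem_chainsIn (map_subtype_mem_chainsIn a))
          (boundary_mem_chainsIn he₁)
      · rw [hc]
        exact Submodule.add_mem _ (subdivision_mem_chainsIn (map_subtype_mem_chainsIn b))
          (boundary_mem_chainsIn he₂))
  have hcz : c ∈ cycles κ (O₁ ∩ O₂ : Set X) r := by
    rw [LinearMap.mem_ker]
    apply map_subtype_injective
    rw [← differential_map, hc', map_sub, differential_subdivision, differential_boundary,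
      LinearMap.mem_ker.1 hja, map_zero, sub_zero, map_zero]
  refine ⟨homologyClass κ _ r ⟨c, hcz⟩, ?_, ?_⟩
  · refine (singularHomologyMap_homologyClass ⟨_, continuous_inclusion _⟩ r _).trans ?_
    refine homologyClass_eq_of_boundary _ _
      (w := -subdivisionHomotopy k (r + 1) (map (j O₁) (r + 1) a) - e₁) ?_ ?_
    · exact Submodule.sub_mem _ (Submodule.neg_mem _
        (subdivisionHomotopy_mem_chainsIn (map_subtype_mem_chainsIn a))) he₁
    · dsimp only
      rw [map_map, map_sub, map_neg, boundary_subdivisionHomotopy_of_mem_cycles k hja]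
      refine Eq.trans ?_ (congrArg (· - map (j O₁) (r + 1) a) hc'.symm)
      abel
  · refine (singularHomologyMap_homologyClass ⟨_, continuous_inclusion _⟩ r _).trans ?_
    refine homologyClass_eq_of_boundary _ _
      (w := -subdivisionHomotopy k (r + 1) (map (j O₂) (r + 1) b) + e₂) ?_ ?_
    · exact Submodule.add_mem _ (Submodule.neg_mem _
        (subdivisionHomotopy_mem_chainsIn (map_subtype_mem_chainsIn b))) he₂
    · dsimp only
      rw [map_map, map_add, map_neg, boundary_subdivisionHomotopy_of_mem_cycles k hjb]
      refine Eq.trans ?_ (congrArg (· - map (j O₂) (r + 1) b) (hc'.trans hc).symm)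
      abel

end

/-! ### Neighbourhoods of closed ANR subspaces -/

/-- The tube lemma, for a homotopy which is continuous only near `V`. -/
theorem isOpen_setOf_forall_mem {X Y I : Type*} [TopologicalSpace X] [TopologicalSpace Y]
    [TopologicalSpace I] [CompactSpace I] {V : Set X} (hV : IsOpen V) {H : X × I → Y}
    (hH : ContinuousOn H (V ×ˢ univ)) {O : Set Y} (hO : IsOpen O) :
    IsOpen {x | x ∈ V ∧ ∀ s, H (x, s) ∈ O} := by
  have h₁ : IsOpen ((V ×ˢ univ) ∩ H ⁻¹' O) := hH.isOpen_inter_preimage (hV.prod isOpen_univ) hO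
  have h₂ := (isClosedMap_fst_of_compactSpace (X := X) (Y := I) _ h₁.isClosed_compl).isOpen_compl
  convert hV.inter h₂ using 1
  ext x
  constructor
  · rintro ⟨hx, h⟩
    refine ⟨hx, ?_⟩
    rintro ⟨⟨y, s⟩, hys, rfl⟩
    exact hys ⟨⟨hx, trivial⟩, h s⟩
  · rintro ⟨hx, h⟩
    exact ⟨hx, fun s => by_contra fun hs => h ⟨(x, s), fun h' => hs h'.2, rfl⟩⟩

/-- A normal space with a proper map `f` to the line is a closed subspace of the normal space
`ℝ × [0,1]^J`, where `J` is the set of all continuous functions to `[0,1]`: the normality of the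
target comes from its σ-compactness, and `f` makes the canonical map closed. -/
theorem isClosedEmbedding_prodMk_eval {X : Type u} [TopologicalSpace X] [T4Space X] {f : X → ℝ}
    (hf : IsProperMap f) :
    IsClosedEmbedding fun x => (f x, fun φ : C(X, unitInterval) => φ x) := by
  have hc : Continuous fun x => (f x, fun φ : C(X, unitInterval) => φ x) :=
    hf.continuous.prodMk (continuous_pi fun φ => φ.continuous)
  refine IsClosedEmbedding.of_continuous_injective_isClosedMap hc (fun x y hxy => ?_)
    (isProperMap_of_comp_of_t2 hc continuous_fst hf).isClosedMap
  by_contra hne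
  obtain ⟨φ, hφc, hφx, hφy⟩ :=
    CompletelyRegularSpace.completely_regular x {y} isClosed_singleton hne
  have h := congrFun (congrArg Prod.snd hxy) ⟨φ, hφc⟩
  have hy : φ y = 1 := hφy rfl
  change φ x = φ y at h
  rw [hφx, hy] at h
  exact zero_ne_one h

/-- A closed ANR subspace `L` of an ANR with a proper map to the line is a strong deformation
retract of a neighbourhood, inside the ambient space: embed the ambient space in a normal convex set
and use the straight line homotopy there, followed by a neighbourhood retraction. -/
theorem IsANR.exists_deformation {X : Type u} [TopologicalSpace X] (hX : IsANR X) {f : X → ℝ}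
    (hf : IsProperMap f) {L : Set X} (hLc : IsClosed L) (hL : IsANR L) :
    ∃ (V : Set X) (ρ : X → X) (H : X × unitInterval → X), IsOpen V ∧ L ⊆ V ∧
      ContinuousOn ρ V ∧ (∀ x ∈ V, ρ x ∈ L) ∧ (∀ x ∈ L, ρ x = x) ∧
      ContinuousOn H (V ×ˢ univ) ∧ (∀ x ∈ V, H (x, 0) = x) ∧ (∀ x ∈ V, H (x, 1) = ρ x) ∧
      ∀ x ∈ L, ∀ s, H (x, s) = x := by
  classical
  have := hX.t4Space
  obtain ⟨U₁, hU₁, hLU₁, ρ₀, hρ₀⟩ :=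
    hL.exists_retraction X Subtype.val hLc.isClosedEmbedding_subtypeVal
  have hi := isClosedEmbedding_prodMk_eval hf
  set i : X → ℝ × (C(X, unitInterval) → unitInterval) := fun x => (f x, fun φ => φ x) with hidef
  obtain ⟨U₂, hU₂, hXU₂, π, hπ⟩ :=
    hX.exists_retraction (ℝ × (C(X, unitInterval) → unitInterval)) i hi
  let ρ : X → X := fun x => if h : x ∈ U₁ then ρ₀ ⟨x, h⟩ else x
  have hρ : ContinuousOn ρ U₁ := by
    rw [continuousOn_iff_continuous_domRestrict]
    refine (continuous_subtype_val.comp ρ₀.continuous).congr fun x => ?_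
    simp [ρ]
  have hρL : ∀ x ∈ U₁, ρ x ∈ L := fun x hx => by simp only [ρ, hx, dif_pos]; exact (ρ₀ _).2
  have hρid : ∀ x ∈ L, ρ x = x := fun x hx => by
    have hx' : x ∈ U₁ := hLU₁ ⟨x, hx⟩
    simp only [ρ, hx', dif_pos]
    exact congrArg Subtype.val (hρ₀ ⟨x, hx⟩)
  -- the straight line from `y` to `z`; the projection to `[0,1]` only serves to have the right type
  let l : unitInterval → (ℝ × (C(X, unitInterval) → unitInterval)) →
      (ℝ × (C(X, unitInterval) → unitInterval)) → ℝ × (C(X, unitInterval) → unitInterval) :=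
    fun s y z => ((1 - s : ℝ) * y.1 + s * z.1, fun φ => projIcc 0 1 zero_le_one
      ((1 - s : ℝ) * (y.2 φ : ℝ) + s * (z.2 φ : ℝ)))
  have hl0 : ∀ y z, l 0 y z = y := fun y z => by
    refine Prod.ext (by simp [l]) (funext fun φ => ?_)
    simp [l]
  have hl1 : ∀ y z, l 1 y z = z := fun y z => by
    refine Prod.ext (by simp [l]) (funext fun φ => ?_)
    simp [l]
  have hly : ∀ s y, l s y y = y := fun s y => by
    refine Prod.ext ?_ (funext fun φ => ?_)
    · simp only [l]; ring
    · simp only [l]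
      rw [← add_mul, sub_add_cancel, one_mul, projIcc_val]
  let h : X × unitInterval → ℝ × (C(X, unitInterval) → unitInterval) :=
    fun p => l p.2 (i p.1) (i (ρ p.1))
  have hh : ContinuousOn h (U₁ ×ˢ univ) := by
    have h1 : ContinuousOn (fun p : X × unitInterval => i p.1) (U₁ ×ˢ univ) :=
      (hi.continuous.comp continuous_fst).continuousOn
    have h2 : ContinuousOn (fun p : X × unitInterval => i (ρ p.1)) (U₁ ×ˢ univ) :=
      hi.continuous.comp_continuousOn (hρ.comp continuous_fst.continuousOn fun p hp => hp.1)
    have hlc : Continuous fun q : unitInterval × (ℝ × (C(X, unitInterval) → unitInterval)) ×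
        (ℝ × (C(X, unitInterval) → unitInterval)) => l q.1 q.2.1 q.2.2 := by
      refine Continuous.prodMk (by fun_prop) (continuous_pi fun φ => ?_)
      exact continuous_projIcc.comp (by fun_prop)
    exact hlc.comp_continuousOn (continuous_snd.continuousOn.prodMk (h1.prodMk h2))
  let H : X × unitInterval → X := fun p => if hp : h p ∈ U₂ then π ⟨h p, hp⟩ else p.1
  have hHc : ContinuousOn H {p | p ∈ U₁ ×ˢ (univ : Set unitInterval) ∧ h p ∈ U₂} := by
    rw [continuousOn_iff_continuous_domRestrict]
    have : Continuous fun p : {p | p ∈ U₁ ×ˢ (univ : Set unitInterval) ∧ h p ∈ U₂} =>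
        (⟨h p, p.2.2⟩ : U₂) :=
      ((hh.mono fun p hp => hp.1).domRestrict).subtype_mk fun p => p.2.2
    refine (π.continuous.comp this).congr fun p => ?_
    have hp : h p ∈ U₂ := p.2.2
    simp [H, hp]
  have hHi : ∀ p x, h p = i x → H p = x := fun p x hp => by
    have hp' : h p ∈ U₂ := hp ▸ hXU₂ x
    simp only [H, hp', dif_pos]
    have : (⟨h p, hp'⟩ : U₂) = ⟨i x, hXU₂ x⟩ := Subtype.ext hp
    rw [this, hπ]
  refine ⟨{x | x ∈ U₁ ∧ ∀ s, h (x, s) ∈ U₂}, ρ, H, isOpen_setOf_forall_mem hU₁ hh hU₂,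
    fun x hx => ⟨hLU₁ ⟨x, hx⟩, fun s => ?_⟩, hρ.mono fun x hx => hx.1, fun x hx => hρL x hx.1, hρid,
    hHc.mono fun p hp => ⟨⟨hp.1.1, trivial⟩, hp.1.2 p.2⟩, fun x hx => hHi _ _ (hl0 _ _),
    fun x hx => hHi _ _ (hl1 _ _), fun x hx s => hHi _ _ ?_⟩
  · simp only [h, hρid x hx, hly]
    exact hXU₂ x
  · simp only [h, hρid x hx, hly]

/-! ### The Mayer–Vietoris property across a level -/

section

variable {κ : Type u} [Field κ] {X Y : Type u} [TopologicalSpace X] [TopologicalSpace Y]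

theorem singularHomologyInclusion_trans (r : ℕ) {A B C : Set X} (h₁ : A ⊆ B) (h₂ : B ⊆ C)
    (a : singularHomology κ r A) :
    singularHomologyInclusion κ r h₂ (singularHomologyInclusion κ r h₁ a) =
      singularHomologyInclusion κ r (h₁.trans h₂) a :=
  singularHomologyMap_comp r ⟨_, continuous_inclusion h₂⟩ ⟨_, continuous_inclusion h₁⟩ a

/-- If `S` is closed and open in `T`, then the homology of `S` injects into that of `T`. -/
theorem singularHomologyInclusion_injective (r : ℕ) {S T C : Set X} (hS : IsClosed S)
    (hC : IsClosed C) (hST : S ⊆ T) (hT : T ⊆ S ∪ C) (hSC : Disjoint S C) :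
    Function.Injective (singularHomologyInclusion κ r hST) := by
  classical
  rcases isEmpty_or_nonempty S with hE | ⟨⟨p⟩⟩
  · have := singularHomology_subsingleton_of_isEmpty (κ := κ) (X := S) r
    exact Function.injective_of_subsingleton _
  · let q : C(T, S) := ⟨fun x => if h : (x : X) ∈ S then ⟨x, h⟩ else p, by
      have hcl : IsClopen ((↑) ⁻¹' S : Set T) := by
        refine ⟨hS.preimage continuous_subtype_val, ?_⟩
        rw [← isClosed_compl_iff]
        convert hC.preimage (continuous_subtype_val (p := (· ∈ T))) using 1
        ext x
        refine ⟨fun hx => (hT x.2).resolve_left hx, fun hx hx' => hSC.le_bot ⟨hx', hx⟩⟩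
      rw [continuous_induced_rng]
      have : (Subtype.val ∘ fun x : T => if h : (x : X) ∈ S then (⟨x, h⟩ : S) else p) =
          ((↑) ⁻¹' S : Set T).piecewise (fun x => (x : X)) fun _ => (p : X) := by
        funext x
        by_cases h : (x : X) ∈ S <;> simp [h, Set.piecewise]
      rw [this]
      exact continuous_subtype_val.piecewise (by simp [hcl.frontier_eq]) continuous_const⟩
    refine Function.LeftInverse.injective (g := singularHomologyMap κ r q) fun a => ?_
    refine (singularHomologyMap_comp r q ⟨_, continuous_inclusion hST⟩ a).trans ?_
    have : q.comp ⟨_, continuous_inclusion hST⟩ = ContinuousMap.id S := by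
      ext1 x
      have hx : (x : X) ∈ S := x.2
      simp [q, hx]
    rw [this, singularHomologyMap_id]

/-- Let `φ ≤ 0` on `A`, let `L = φ⁻¹(0) ⊆ A`, and let `ρ` be a retraction of a neighbourhood `V` of
`L` to `L` which is homotopic to the identity by a homotopy `H` relative to `L`. If `V'` is so small
that `H` takes `V' × [0,1]` into `V`, the points with `φ ≤ 0` being in `A`, then a class of `V'`
which agrees in `A ∪ V'` with a class of `A` is mapped to that class by `ρ`. For, replacing the
points with `φ > 0` by their images under `ρ` retracts `A ∪ V'` to `A`, and turns `H` into a
homotopy in `A`. -/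
theorem singularHomologyInclusion_retraction (r : ℕ) {φ : X → ℝ} (hφ : Continuous φ)
    {A L V V' : Set X} {ρ : X → X} {H : X × unitInterval → X} (hA : ∀ x ∈ A, φ x ≤ 0)
    (hL : ∀ x, x ∈ L ↔ φ x = 0) (hLA : L ⊆ A) (hLV : L ⊆ V)
    (hρ : ContinuousOn ρ V) (hρL : ∀ x ∈ V, ρ x ∈ L) (hρid : ∀ x ∈ L, ρ x = x)
    (hH : ContinuousOn H (V ×ˢ univ)) (hH0 : ∀ x ∈ V, H (x, 0) = x)
    (hH1 : ∀ x ∈ V, H (x, 1) = ρ x) (hHL : ∀ x ∈ L, ∀ s, H (x, s) = x) (hV' : V' ⊆ V)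
    (hHV' : ∀ x ∈ V', ∀ s, H (x, s) ∈ V ∧ (φ (H (x, s)) ≤ 0 → H (x, s) ∈ A))
    (ρ' : C(V', L)) (hρ' : ∀ x : V', (ρ' x : X) = ρ x)
    (c : singularHomology κ r V') (a : singularHomology κ r A)
    (hca : singularHomologyInclusion κ r (subset_union_right (s := A)) c =
      singularHomologyInclusion κ r subset_union_left a) :
    singularHomologyInclusion κ r hLA (singularHomologyMap κ r ρ' c) = a := by
  classical
  let q : X → X := fun x => if φ x ≤ 0 then x else ρ x
  have hcl₁ : closure {x : X | φ x ≤ 0} = {x | φ x ≤ 0} :=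
    (isClosed_le hφ continuous_const).closure_eq
  have hcl₂ : closure {x : X | ¬ φ x ≤ 0} ⊆ {x | 0 ≤ φ x} :=
    closure_minimal (fun x hx => (not_le.1 hx).le) (isClosed_le continuous_const hφ)
  have hfr : ∀ x ∈ frontier {x : X | φ x ≤ 0}, x ∈ L := fun x hx =>
    (hL x).2 (frontier_le_subset_eq hφ continuous_const hx)
  have hq : ∀ S : Set X, (∀ x ∈ S, 0 ≤ φ x → x ∈ V) → ContinuousOn q S := fun S hS => by
    refine ContinuousOn.if (fun x hx => (hρid x (hfr x hx.2)).symm) continuousOn_id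
      (hρ.mono fun x hx => hS x hx.1 (hcl₂ hx.2))
  have hqL : ∀ x ∈ L, q x = x := fun x hx => if_pos ((hL x).1 hx).le
  have hqA : ∀ x ∈ A, q x = x := fun x hx => if_pos (hA x hx)
  have hqmem : ∀ x ∈ V, (φ x ≤ 0 → x ∈ A) → q x ∈ A := fun x hx h => by
    by_cases hx0 : φ x ≤ 0
    · simpa [q, hx0] using h hx0
    · simpa [q, hx0] using hLA (hρL x hx)
  have hV'A : ∀ x ∈ V', φ x ≤ 0 → x ∈ A := fun x hx h => by
    have := (hHV' x hx 0).2
    rw [hH0 x (hV' hx)] at this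
    exact this h
  let R : C((A ∪ V' : Set X), A) := ⟨fun x => ⟨q x, x.2.elim
      (fun hx => (hqA _ hx).symm ▸ hx) (fun hx => hqmem _ (hV' hx) (hV'A _ hx))⟩,
    ((hq (A ∪ V') fun x hx h0 => hx.elim
      (fun hx => hLV ((hL x).2 (le_antisymm (hA x hx) h0)))
        (fun hx => hV' hx)).domRestrict).subtype_mk _⟩
  let k : unitInterval × X → X := fun p => if φ p.2 ≤ 0 then q (H (p.2, p.1)) else ρ p.2
  have hk : ContinuousOn k (univ ×ˢ V') := by
    have hφ' : Continuous fun p : unitInterval × X => φ p.2 := hφ.comp continuous_snd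
    refine ContinuousOn.if (fun p hp => ?_) ?_ ?_
    · have hp' : p.2 ∈ L := (hL _).2 (frontier_le_subset_eq hφ' continuous_const hp.2)
      rw [hHL _ hp', hqL _ hp', hρid _ hp']
    · refine ((hq V fun x hx _ => hx).comp
        (hH.comp (f := fun p : unitInterval × X => (p.2, p.1)) continuous_swap.continuousOn
          fun p hp => ⟨hV' hp.2, trivial⟩) fun p hp => (hHV' _ hp.2 _).1).mono fun p hp => hp.1
    · exact (hρ.comp continuous_snd.continuousOn fun p hp => hV' hp.2).mono fun p hp => hp.1
  have hkA : ∀ p ∈ (univ : Set unitInterval) ×ˢ V', k p ∈ A := fun p hp => by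
    by_cases h : φ p.2 ≤ 0
    · simpa only [k, h, if_true] using hqmem _ (hHV' _ hp.2 _).1 (hHV' _ hp.2 _).2
    · simpa only [k, h, if_false] using hLA (hρL _ (hV' hp.2))
  let K : ContinuousMap.Homotopy
      (R.comp ⟨_, continuous_inclusion (subset_union_right (s := A) (t := V'))⟩)
      ((⟨_, continuous_inclusion hLA⟩ : C(L, A)).comp ρ') :=
    { toFun := fun p => ⟨k (p.1, p.2), hkA _ ⟨trivial, p.2.2⟩⟩
      continuous_toFun := by
        refine Continuous.subtype_mk ?_ _
        exact hk.comp_continuous (f := fun p : unitInterval × V' => (p.1, (p.2 : X)))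
          (by fun_prop) fun p => ⟨trivial, p.2.2⟩
      map_zero_left := fun x => by
        refine Subtype.ext ?_
        change k (0, x) = q x
        by_cases h : φ x ≤ 0
        · simp only [k, h, if_true, hH0 _ (hV' x.2)]
        · simp only [k, h, if_false, q]
      map_one_left := fun x => by
        refine Subtype.ext ?_
        change k (1, x) = ρ' x
        rw [hρ']
        by_cases h : φ x ≤ 0
        · simp only [k, h, if_true, hH1 _ (hV' x.2), hqL _ (hρL _ (hV' x.2))]
        · simp only [k, h, if_false] }
  refine (singularHomologyMap_comp r ⟨_, continuous_inclusion hLA⟩ ρ' c).trans ?_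
  rw [← singularHomologyMap_eq_of_homotopy r K, ← singularHomologyMap_comp]
  refine (congrArg (singularHomologyMap κ r R) hca).trans ?_
  refine (singularHomologyMap_comp r R ⟨_, continuous_inclusion subset_union_left⟩ a).trans ?_
  have : R.comp ⟨_, continuous_inclusion (subset_union_left (s := A) (t := V'))⟩ =
      ContinuousMap.id A := by
    ext1 x
    exact Subtype.ext (hqA _ x.2)
  rw [this, singularHomologyMap_id]

/-- Mayer–Vietoris for two subsets which lie on the two sides of a level `L = φ⁻¹(0)`, where `L` is
an ANR and the subsets together form a neighbourhood of `L`. -/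
theorem exists_level_singularHomologyInclusion_eq (hX : IsANR X) {f : X → ℝ} (hf : IsProperMap f)
    (r : ℕ) {φ : X → ℝ} (hφ : Continuous φ) {A B L W : Set X} (hL : ∀ x, x ∈ L ↔ φ x = 0)
    (hLANR : IsANR L) (hA : ∀ x ∈ A, φ x ≤ 0) (hB : ∀ x ∈ B, 0 ≤ φ x) (hLA : L ⊆ A) (hLB : L ⊆ B)
    (hW : IsOpen W) (hLW : L ⊆ W) (hWAB : W ⊆ A ∪ B)
    (a : singularHomology κ r A) (b : singularHomology κ r B)
    (hab : singularHomologyInclusion κ r subset_union_left a =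
      singularHomologyInclusion κ r (subset_union_right (s := A)) b) :
    ∃ c : singularHomology κ r L,
      singularHomologyInclusion κ r hLA c = a ∧ singularHomologyInclusion κ r hLB c = b := by
  have hLc : IsClosed L := by
    have : L = φ ⁻¹' {0} := ext hL
    rw [this]
    exact isClosed_singleton.preimage hφ
  obtain ⟨V, ρ, H, hV, hLV, hρ, hρL, hρid, hH, hH0, hH1, hHL⟩ := hX.exists_deformation hf hLc hLANR
  set V' : Set X := {x | x ∈ V ∧ ∀ s, H (x, s) ∈ V ∩ W} with hV'def
  have hV'o : IsOpen V' := isOpen_setOf_forall_mem hV hH (hV.inter hW)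
  have hV'V : V' ⊆ V := fun x hx => hx.1
  have hLV' : L ⊆ V' := fun x hx => ⟨hLV hx, fun s => by
    rw [hHL x hx]
    exact ⟨hLV hx, hLW hx⟩⟩
  have hHA : ∀ x ∈ V', ∀ s, H (x, s) ∈ V ∧ (φ (H (x, s)) ≤ 0 → H (x, s) ∈ A) := fun x hx s =>
    ⟨(hx.2 s).1, fun h => (hWAB (hx.2 s).2).elim id fun h' =>
      hLA ((hL _).2 (le_antisymm h (hB _ h')))⟩
  have hHB : ∀ x ∈ V', ∀ s, H (x, s) ∈ V ∧ (-φ (H (x, s)) ≤ 0 → H (x, s) ∈ B) := fun x hx s =>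
    ⟨(hx.2 s).1, fun h => (hWAB (hx.2 s).2).elim (fun h' =>
      hLB ((hL _).2 (le_antisymm (hA _ h') (by linarith)))) id⟩
  have hAV : ∀ x ∈ A, 0 ≤ φ x → x ∈ V' := fun x hx h =>
    hLV' ((hL x).2 (le_antisymm (hA x hx) h))
  have hBV : ∀ x ∈ B, φ x ≤ 0 → x ∈ V' := fun x hx h =>
    hLV' ((hL x).2 (le_antisymm h (hB x hx)))
  have hVAB : ∀ x ∈ V', x ∈ A ∨ x ∈ B := fun x hx => by
    have := (hx.2 0).2
    rw [hH0 x hx.1] at this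
    exact hWAB this
  obtain ⟨c, hca, hcb⟩ := exists_singularHomologyInclusion_eq (κ := κ) r
    (O₁ := A ∪ V') (O₂ := B ∪ V') (U₁ := {x | φ x < 0} ∪ V') (U₂ := {x | 0 < φ x} ∪ V')
    ((isOpen_lt hφ continuous_const).union hV'o) ((isOpen_lt continuous_const hφ).union hV'o)
    (by
      ext x
      constructor
      · rintro ⟨(hx | hx) | (hx | hx), h | h⟩
        · exact Or.inl hx
        · exact Or.inl hx
        · exact Or.inr hx
        · exact Or.inr hx
        · exact absurd h (not_lt.2 (hB x hx))
        · exact Or.inr h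
        · exact Or.inr hx
        · exact Or.inr hx
      · intro hx
        refine ⟨Or.inl hx, hx.elim (fun hx => ?_) Or.inr⟩
        exact (lt_or_ge (φ x) 0).imp id (hAV x hx))
    (by
      ext x
      constructor
      · rintro ⟨(hx | hx) | (hx | hx), h | h⟩
        · exact absurd h (not_lt.2 (hA x hx))
        · exact Or.inr h
        · exact Or.inr hx
        · exact Or.inr hx
        · exact Or.inl hx
        · exact Or.inl hx
        · exact Or.inr hx
        · exact Or.inr hx
      · intro hx
        refine ⟨Or.inr hx, hx.elim (fun hx => ?_) Or.inr⟩
        exact (lt_or_ge 0 (φ x)).imp id (hBV x hx))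
    (singularHomologyInclusion κ r subset_union_left a)
    (singularHomologyInclusion κ r subset_union_left b)
    (by
      have hsub : A ∪ B ⊆ (A ∪ V') ∪ (B ∪ V') :=
        union_subset_union subset_union_left subset_union_left
      have := congrArg (singularHomologyInclusion κ r hsub) hab
      rw [singularHomologyInclusion_trans, singularHomologyInclusion_trans] at this
      rwa [singularHomologyInclusion_trans, singularHomologyInclusion_trans])
  have hinter : (A ∪ V') ∩ (B ∪ V') ⊆ V' := by
    rintro x ⟨hx | hx, hx' | hx'⟩
    · exact hAV x hx (hB x hx')
    · exact hx'
    · exact hx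
    · exact hx
  let ρ' : C(V', L) := ⟨fun x => ⟨ρ x, hρL _ (hV'V x.2)⟩, ((hρ.mono hV'V).domRestrict).subtype_mk _⟩
  refine ⟨singularHomologyMap κ r ρ' (singularHomologyInclusion κ r hinter c), ?_, ?_⟩
  · refine singularHomologyInclusion_retraction r hφ hA hL hLA hLV hρ hρL hρid hH hH0 hH1 hHL hV'V
      hHA ρ' (fun _ => rfl) _ a ?_
    rw [singularHomologyInclusion_trans, ← hca]
  · refine singularHomologyInclusion_retraction r hφ.neg (fun x hx => neg_nonpos.2 (hB x hx))
      (fun x => (hL x).trans neg_eq_zero.symm) hLB hLV hρ hρL hρid hH hH0 hH1 hHL hV'V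
      hHB ρ' (fun _ => rfl) _ b ?_
    rw [singularHomologyInclusion_trans, ← hcb]

end

theorem proposition3p2 (κ : Type u) [Field κ] (r : ℕ) (X : Type u) [TopologicalSpace X]
    (hX : IsANR X) (f g : X → ℝ) (hf : IsProperMap f) (hg : IsProperMap g)
    (t₁ t₂ t₃ : ℝ) (h₁₂ : t₁ < t₂) (h₂₃ : t₂ < t₃)
    (hreg₁ : IsWeaklyRegular f t₁) (hreg₂ : IsWeaklyRegular g t₂)
    -- the level inclusions without which the two relations on the left are not defined
    (hlev₁ : f ⁻¹' {t₁} ⊆ g ⁻¹' Iio t₂) (hlev₃ : f ⁻¹' {t₃} ⊆ g ⁻¹' Ioi t₂)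
    (hlev₂ : g ⁻¹' {t₂} ⊆ f ⁻¹' Ioo t₁ t₃) :
    LinearRelation.comp
        (levelRelation κ r g f t₂ t₃
          (level_left_subset (hlev₂.trans (preimage_mono Ioo_subset_Iio_self))) (level_right_subset hlev₃))
        (levelRelation κ r f g t₁ t₂
          (level_left_subset hlev₁) (level_right_subset (hlev₂.trans (preimage_mono Ioo_subset_Ioi_self)))) =
      levelRelation κ r f f t₁ t₃
        (level_left_subset (level_subset_Iio (h₁₂.trans h₂₃)))
        (level_right_subset (level_subset_Ioi (h₁₂.trans h₂₃))) := by
  have hfc := hf.continuous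
  have hgc := hg.continuous
  set A := levelRegion f g t₁ t₂ with hA
  set B := levelRegion g f t₂ t₃ with hB
  set S := levelRegion f f t₁ t₃ with hS
  have hST : S ⊆ A ∪ B := fun x hx =>
    (le_total (g x) t₂).imp (fun h => ⟨h, hx.2⟩) fun h => ⟨hx.1, h⟩
  -- `A` may contain points with `f > t₃` and `B` points with `f < t₁`, but such points are
  -- separated from `S` because `f` takes the value `t₃` only where `g > t₂`, and `t₁` only where
  -- `g < t₂`
  have hinj : Function.Injective (singularHomologyInclusion κ r hST) := by
    refine singularHomologyInclusion_injective r (C := (g ⁻¹' Iic t₂ ∩ f ⁻¹' Ici t₃) ∪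
      (g ⁻¹' Ici t₂ ∩ f ⁻¹' Iic t₁)) ((isClosed_Iic.preimage hfc).inter (isClosed_Ici.preimage hfc))
      (((isClosed_Iic.preimage hgc).inter (isClosed_Ici.preimage hfc)).union
        ((isClosed_Ici.preimage hgc).inter (isClosed_Iic.preimage hfc))) hST ?_ ?_
    · rintro x (hx | hx)
      · exact (le_total (f x) t₃).imp (fun h => ⟨h, hx.2⟩) fun h => Or.inl ⟨hx.1, h⟩
      · exact (le_total t₁ (f x)).imp (fun h => ⟨hx.1, h⟩) fun h => Or.inr ⟨hx.2, h⟩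
    · rw [Set.disjoint_left]
      rintro x hx (hx' | hx')
      · exact absurd (hlev₃ (le_antisymm hx.1 hx'.2 : f x = t₃))
          (show ¬ t₂ < g x from not_lt.2 hx'.1)
      · exact absurd (hlev₁ (le_antisymm hx'.2 hx.2 : f x = t₁))
          (show ¬ g x < t₂ from not_lt.2 hx'.1)
  ext ⟨v₁, v₃⟩
  constructor
  · rintro ⟨v₂, h₁, h₂⟩
    refine hinj ?_
    have h₁' := congrArg (singularHomologyInclusion κ r (subset_union_left (s := A) (t := B))) h₁
    have h₂' := congrArg (singularHomologyInclusion κ r (subset_union_right (s := A) (t := B))) h₂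
    rw [singularHomologyInclusion_trans, singularHomologyInclusion_trans] at h₁' h₂' ⊢
    exact h₁'.trans h₂'
  · intro h
    obtain ⟨c, hc₁, hc₂⟩ := exists_level_singularHomologyInclusion_eq (κ := κ) hX hf r
      (φ := fun x => g x - t₂) (hgc.sub continuous_const) (A := A) (B := B) (L := g ⁻¹' {t₂})
      (W := f ⁻¹' Ioo t₁ t₃) (fun x => sub_eq_zero.symm) hreg₂ (fun x hx => sub_nonpos.2 hx.1)
      (fun x hx => sub_nonneg.2 hx.2)
      (level_right_subset (hlev₂.trans (preimage_mono Ioo_subset_Ioi_self)))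
      (level_left_subset (hlev₂.trans (preimage_mono Ioo_subset_Iio_self)))
      (isOpen_Ioo.preimage hfc) hlev₂
      (fun x hx => (le_total (g x) t₂).imp (fun h => ⟨h, hx.1.le⟩) fun h => ⟨hx.2.le, h⟩)
      (singularHomologyInclusion κ r (level_left_subset hlev₁) v₁)
      (singularHomologyInclusion κ r (level_right_subset hlev₃) v₃) (by
        have h' := congrArg (singularHomologyInclusion κ r hST) h
        rw [singularHomologyInclusion_trans, singularHomologyInclusion_trans] at h' ⊢
        exact h')
    exact ⟨c, hc₁.symm, hc₂⟩
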